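/- Let $d\ge 0$ and let $M$ be a smooth (Hausdorff, second countable) manifold of dimension $2d+1$ without boundary. A *stable Hamiltonian structure* on $M$ is a pair $(\Omega,\alpha)$ consisting of a smooth closed 2-form $\Omega$ such that $\Omega^d$ vanishes nowhere, and a smooth 1-form $\alpha$ such that $\alpha\wedge\Omega^d$ vanishes nowhere and $\ker\Omega\subseteq\ker d\alpha$. Its *Reeb field* is the vector field $E$ with $i_E\Omega=0$ and $\alpha(E)=1$. **Theorem.** Let $(\Omega,\alpha)$ be a stable Hamiltonian structure on $M$. Then there is exactly one vector field $E$ on $M$ with $i_E\Omega=0$ and $\alpha(E)=1$, it is smooth, and the following hold. 1. There is a smooth torsion-free linear connection $\nabla$ on $TM$ with $$\nabla E=0,\qquad \nabla\Omega=0.$$ Such a connection is called an *shs connection*. 2. If $d\ge 1$ and $M$ is non-empty, there are infinitely many shs connections on $M$. 3. If $\Omega=d\alpha$ (the contact case), the shs connections are exactly Lichnerowicz's contact connections, that is, the smooth torsion-free linear connections $\nabla$ with $\nabla E=0$ and $\nabla\, d\alpha=0$. -/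

import Mathlib

open Bundle
open scoped Manifold ContDiff

noncomputable section

namespace StableHamiltonian

/-! ### Multilinear algebra -/

/-- The wedge product of two alternating forms,
`(f ∧ g)(v₁, …, v_{k+l}) = ∑ sgn(σ) f(v_{σ 1}, …, v_{σ k}) g(v_{σ (k+1)}, …, v_{σ (k+l)})`,
the sum being over all `(k, l)`-shuffles `σ`. -/
def wedge {V : Type*} [AddCommGroup V] [Module ℝ V] {k l : ℕ}
    (f : V [⋀^Fin k]→ₗ[ℝ] ℝ) (g : V [⋀^Fin l]→ₗ[ℝ] ℝ) : V [⋀^Fin (k + l)]→ₗ[ℝ] ℝ :=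
  ((LinearMap.mul' ℝ ℝ).compAlternatingMap (f.domCoprod g)).domDomCongr finSumFinEquiv

/-- The power `β ^ k = β ∧ ⋯ ∧ β` of a 2-form; `β ^ 0` is the constant `1`. -/
def wedgePow {V : Type*} [AddCommGroup V] [Module ℝ V] (β : V [⋀^Fin 2]→ₗ[ℝ] ℝ) :
    (k : ℕ) → V [⋀^Fin (2 * k)]→ₗ[ℝ] ℝ
  | 0 => haveI : IsEmpty (Fin (2 * 0)) := Fin.isEmpty
    AlternatingMap.constOfIsEmpty ℝ V (Fin (2 * 0)) (1 : ℝ)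
  | k + 1 => wedge (wedgePow β k) β

/-! ### Differential forms on a manifold of dimension `n` -/

section Forms

variable {n : ℕ} (M : Type*) [TopologicalSpace M] [ChartedSpace (EuclideanSpace ℝ (Fin n)) M]

/-- A (not necessarily smooth) differential `k`-form on `M`. -/
abbrev DiffForm (k : ℕ) : Type _ :=
  ∀ x : M, TangentSpace (𝓡 n) x [⋀^Fin k]→L[ℝ] ℝ

variable {M} {k : ℕ}

/-- The expression of a differential form in the preferred chart `φ` at `x₀`: its pull-back under
`φ⁻¹`, a differential form on the target of `φ` in `ℝⁿ`. -/
def DiffForm.inChart (β : DiffForm (n := n) M k) (x₀ : M) :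
    EuclideanSpace ℝ (Fin n) → EuclideanSpace ℝ (Fin n) [⋀^Fin k]→L[ℝ] ℝ :=
  fun y ↦ (β ((extChartAt (𝓡 n) x₀).symm y)).compContinuousLinearMap
    (mfderiv 𝓘(ℝ, EuclideanSpace ℝ (Fin n)) (𝓡 n) (extChartAt (𝓡 n) x₀).symm y)

/-- A differential form is smooth if it is smooth in charts. -/
def DiffForm.IsSmooth (β : DiffForm (n := n) M k) : Prop :=
  ∀ x₀ : M, ContDiffOn ℝ ∞ (DiffForm.inChart β x₀) (extChartAt (𝓡 n) x₀).target

/-- The exterior derivative of a differential form, computed at `x` in the chart at `x`. -/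
def DiffForm.extD (β : DiffForm (n := n) M k) : DiffForm (n := n) M (k + 1) :=
  fun x ↦ (extDeriv (β.inChart x) (extChartAt (𝓡 n) x x)).compContinuousLinearMap
    (mfderiv (𝓡 n) 𝓘(ℝ, EuclideanSpace ℝ (Fin n)) (extChartAt (𝓡 n) x) x)

end Forms

/-! ### Stable Hamiltonian structures -/

section Structures

variable {d : ℕ} {M : Type*} [TopologicalSpace M]
  [ChartedSpace (EuclideanSpace ℝ (Fin (2 * d + 1))) M]

/-- A Hamiltonian structure on a manifold of dimension `2d+1`: a closed 2-form `Ω` of maximal rank,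
that is, such that `Ω ^ d` vanishes nowhere. -/
structure IsHamiltonian (Ω : DiffForm (n := 2 * d + 1) M 2) : Prop where
  smooth : DiffForm.IsSmooth Ω
  closed : ∀ x, DiffForm.extD Ω x = 0
  pow_ne_zero : ∀ x, wedgePow (Ω x).toAlternatingMap d ≠ 0

/-- A stable Hamiltonian structure `(Ω, α)`: a Hamiltonian structure `Ω` with a 1-form `α` such that
`α ∧ Ω ^ d` vanishes nowhere and `ker Ω ⊆ ker dα`. -/
structure IsStableHamiltonian (Ω : DiffForm (n := 2 * d + 1) M 2)
    (α : DiffForm (n := 2 * d + 1) M 1) : Prop where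
  isHamiltonian : IsHamiltonian Ω
  smooth : DiffForm.IsSmooth α
  volume_ne_zero : ∀ x, wedge (α x).toAlternatingMap (wedgePow (Ω x).toAlternatingMap d) ≠ 0
  ker_le : ∀ x (u : TangentSpace (𝓡 (2 * d + 1)) x),
    (∀ w, Ω x ![u, w] = 0) → ∀ w, DiffForm.extD α x ![u, w] = 0

/-- `E` is the Reeb field of `(Ω, α)`: `i_E Ω = 0` and `i_E α = 1`. -/
def IsReebField (Ω : DiffForm (n := 2 * d + 1) M 2) (α : DiffForm (n := 2 * d + 1) M 1)
    (E : ∀ x : M, TangentSpace (𝓡 (2 * d + 1)) x) : Prop :=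
  ∀ x, (∀ w, Ω x ![E x, w] = 0) ∧ α x ![E x] = 1

end Structures

/-! ### Linear connections -/

section Connections

variable {n : ℕ} {M : Type*} [TopologicalSpace M] [ChartedSpace (EuclideanSpace ℝ (Fin n)) M]
  [IsManifold (𝓡 n) ∞ M]

variable (M) in
/-- A smooth vector field on `M`. -/
abbrev SmoothVectorField : Type _ :=
  ContMDiffSection (𝓡 n) (EuclideanSpace ℝ (Fin n)) ∞ (TangentSpace (𝓡 n) : M → Type _)

variable (M) in
/-- A Koszul connection on the tangent bundle of `M`; `nabla Y x u` is `(∇_u Y)(x)`. -/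
abbrev LinearConnection : Type _ :=
  CovariantDerivative (𝓡 n) (EuclideanSpace ℝ (Fin n)) (TangentSpace (𝓡 n) : M → Type _)

/-- `∇E = 0`. -/
def IsParallelField (nabla : LinearConnection (n := n) M)
    (E : ∀ x : M, TangentSpace (𝓡 n) x) : Prop :=
  ∀ x, nabla E x = 0

/-- `∇Ω = 0`, that is, `u(Ω(Y, Z)) = Ω(∇_u Y, Z) + Ω(Y, ∇_u Z)` for all smooth vector fields
`Y`, `Z` and all tangent vectors `u`. -/
def IsParallelForm (nabla : LinearConnection (n := n) M) (Ω : DiffForm (n := n) M 2) : Prop :=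
  ∀ (Y Z : SmoothVectorField (n := n) M) (x : M) (u : TangentSpace (𝓡 n) x),
    mfderiv (𝓡 n) 𝓘(ℝ, ℝ) (fun y ↦ Ω y ![Y y, Z y]) x u =
      Ω x ![nabla (fun y ↦ Y y) x u, Z x] + Ω x ![Y x, nabla (fun y ↦ Z y) x u]

/-- A smooth torsion-free linear connection with `∇E = 0` and `∇Ω = 0`. -/
structure IsShsConnection (Ω : DiffForm (n := n) M 2) (E : ∀ x : M, TangentSpace (𝓡 n) x)
    (nabla : LinearConnection (n := n) M) : Prop where
  smooth : nabla.ContMDiffCovariantDerivative ∞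
  torsion_eq_zero : nabla.torsion = 0
  parallel_field : IsParallelField nabla E
  parallel_form : IsParallelForm nabla Ω

/-- A contact connection for the contact form `α` with Reeb field `E`: a smooth torsion-free linear
connection with `∇E = 0` and `∇(dα) = 0`. -/
structure IsContactConnection (α : DiffForm (n := n) M 1) (E : ∀ x : M, TangentSpace (𝓡 n) x)
    (nabla : LinearConnection (n := n) M) : Prop where
  smooth : nabla.ContMDiffCovariantDerivative ∞
  torsion_eq_zero : nabla.torsion = 0
  parallel_field : IsParallelField nabla E
  parallel_form : IsParallelForm nabla (DiffForm.extD α)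

/-- The operator `Y ↦ ∇Y` on smooth vector fields. Two elements of `LinearConnection` are the same
connection in the usual sense precisely when these operators agree: the values of a
`CovariantDerivative` on non-differentiable sections are unconstrained and carry no meaning. -/
def onSmooth (nabla : LinearConnection (n := n) M) :
    SmoothVectorField (n := n) M →
      ∀ x : M, TangentSpace (𝓡 n) x →L[ℝ] TangentSpace (𝓡 n) x :=
  fun Y ↦ nabla (fun y ↦ Y y)

end Connections

end StableHamiltonian

end

/-!
The conditions on an shs connection are affine, so such connections can be constructed in
charts and glued with a partition of unity. In a chart, first correct the trivial connection
by a tensor symmetric in its two arguments so that `E` becomes parallel. The defect `∇Ω` is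
then killed by `E` in each of its arguments and, since `Ω` is closed, has vanishing cyclic
sum. As `Ω + α ⊗ α` is non-degenerate, `(∇Ω)(u, v, w) = Ω(S(u, v), w)` for a tensor `S`
killed by `E`, and adding `(S(u, v) + S(v, u)) / 3` to the connection makes `Ω` parallel
without creating torsion or changing `∇E`. Finally, if `∇` is an shs connection and `X` a
vector field, then `∇ + c (i_X Ω) ⊗ (i_X Ω) ⊗ X` is an shs connection for every real `c`,
because `i_E Ω = 0` and `Ω(Ω(X, u) Ω(X, v) X, w)` is symmetric in `u`, `v`, `w`.
-/

noncomputable section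

set_option maxSynthPendingDepth 3

namespace StableHamiltonian

section AlternatingForms

variable {R V : Type*} [CommRing R] [AddCommGroup V] [Module R V]

/-- The bilinear form of a 2-form. -/
def toBilin (β : V [⋀^Fin 2]→ₗ[R] R) : V →ₗ[R] V →ₗ[R] R :=
  LinearMap.mk₂ R (fun v w ↦ β ![v, w])
    (fun v v' w ↦ β.map_vecCons_add ![w] v v')
    (fun c v w ↦ β.map_vecCons_smul ![w] c v)
    (fun v w w' ↦ (β.curryLeft v).map_vecCons_add ![] w w')
    (fun c v w ↦ (β.curryLeft v).map_vecCons_smul ![] c w)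

@[simp]
theorem toBilin_apply (β : V [⋀^Fin 2]→ₗ[R] R) (v w : V) : toBilin β v w = β ![v, w] := rfl

theorem isAlt_toBilin (β : V [⋀^Fin 2]→ₗ[R] R) : (toBilin β).IsAlt := fun v ↦
  β.map_eq_zero_of_eq ![v, v] (i := 0) (j := 1) rfl zero_ne_one

theorem apply_pair_swap (β : V [⋀^Fin 2]→ₗ[R] R) (v w : V) : β ![v, w] = -β ![w, v] :=
  ((isAlt_toBilin β).neg w v).symm

theorem apply_pair_add_smul_left (β : V [⋀^Fin 2]→ₗ[R] R) (v v' w : V) (c : R) :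
    β ![v + c • v', w] = β ![v, w] + c * β ![v', w] := by
  simp only [← toBilin_apply, map_add, map_smul, LinearMap.add_apply, LinearMap.smul_apply,
    smul_eq_mul]

theorem apply_pair_add_smul_right (β : V [⋀^Fin 2]→ₗ[R] R) (v w w' : V) (c : R) :
    β ![v, w + c • w'] = β ![v, w] + c * β ![v, w'] := by
  simp only [← toBilin_apply, map_add, map_smul, smul_eq_mul]

theorem apply_single_sub (a : V [⋀^Fin 1]→ₗ[R] R) (v w : V) :
    a ![v - w] = a ![v] - a ![w] := by
  have h := a.map_vecCons_add ![] (v - w) w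
  rw [sub_add_cancel] at h
  exact eq_sub_of_add_eq h.symm

/-- The vector `v` is in the kernel of the form `f`, that is, `i_v f = 0`. The condition is on all
the arguments and not only on the first one, so that it also makes sense for 0-forms. -/
def IsKernelVector {k : ℕ} (f : V [⋀^Fin k]→ₗ[R] R) (v : V) : Prop :=
  ∀ m : Fin k → V, v ∈ Set.range m → f m = 0

theorem isKernelVector_of_apply_single_eq_zero {a : V [⋀^Fin 1]→ₗ[R] R} {v : V}
    (h : a ![v] = 0) : IsKernelVector a v := by
  rintro m ⟨i, rfl⟩
  rwa [show m = ![m i] from funext fun j ↦ by rw [Subsingleton.elim j i]; simp]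

theorem isKernelVector_of_apply_pair_eq_zero {β : V [⋀^Fin 2]→ₗ[R] R} {v : V}
    (h : ∀ w, β ![v, w] = 0) : IsKernelVector β v := by
  rintro m ⟨i, rfl⟩
  rw [show m = ![m 0, m 1] from funext fun j ↦ by fin_cases j <;> rfl]
  fin_cases i
  · exact h (m 1)
  · exact (apply_pair_swap β (m 0) (m 1)).trans (neg_eq_zero.2 (h (m 0)))

theorem IsKernelVector.eq_zero {K W : Type*} [Field K] [AddCommGroup W] [Module K W]
    [FiniteDimensional K W] {k : ℕ} (hk : Module.finrank K W = k) {f : W [⋀^Fin k]→ₗ[K] K}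
    (hf : f ≠ 0) {v : W} (hv : IsKernelVector f v) : v = 0 := by
  by_contra hv0
  have hli : LinearIndepOn K id ({v} : Set W) := LinearIndepOn.singleton hv0
  let b := Module.Basis.extend hli
  have hmem : v ∈ hli.extend (Set.subset_univ _) := hli.subset_extend _ rfl
  have : Fintype (hli.extend (Set.subset_univ {v})) := FiniteDimensional.fintypeBasisIndex b
  refine hf (Module.Basis.ext_alternating b fun c hc ↦ ?_)
  have hcard : Fintype.card (Fin k) = Fintype.card (hli.extend (Set.subset_univ {v})) := by
    rw [← Module.finrank_eq_card_basis b, hk, Fintype.card_fin]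
  obtain ⟨i, hi⟩ := ((Fintype.bijective_iff_injective_and_card c).2 ⟨hc, hcard⟩).2 ⟨v, hmem⟩
  exact hv _ ⟨i, (congrArg b hi).trans (Module.Basis.extend_apply_self hli ⟨v, hmem⟩)⟩

theorem exists_ne_zero_apply_eq_zero_of_odd_finrank {K W : Type*} [Field K] [CharZero K]
    [AddCommGroup W] [Module K W] [FiniteDimensional K W] (hodd : Odd (Module.finrank K W))
    {B : W →ₗ[K] W →ₗ[K] K} (hB : B.IsAlt) : ∃ v ≠ 0, ∀ w, B v w = 0 := by
  let b := Module.finBasis K W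
  let A := LinearMap.toMatrix₂ b b B
  have hskew : A.transpose = -A := by
    ext i j
    simp only [A, Matrix.transpose_apply, Matrix.neg_apply, LinearMap.toMatrix₂_apply, hB.neg]
  have hdet : A.det = 0 := by
    have h := A.det_transpose
    rw [hskew, Matrix.det_neg, Fintype.card_fin, hodd.neg_one_pow, neg_one_mul] at h
    exact self_eq_neg.1 h.symm
  have hsep : ¬B.SeparatingLeft := fun h ↦
    (LinearMap.separatingLeft_iff_det_ne_zero b).1 h hdet
  simp only [LinearMap.SeparatingLeft, not_forall] at hsep
  obtain ⟨v, hBv, hv⟩ := hsep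
  exact ⟨v, hv, hBv⟩

end AlternatingForms

section WedgePowers

variable {V : Type*} [AddCommGroup V] [Module ℝ V] {v : V}

theorem IsKernelVector.wedge {k l : ℕ} {f : V [⋀^Fin k]→ₗ[ℝ] ℝ} {g : V [⋀^Fin l]→ₗ[ℝ] ℝ}
    (hf : IsKernelVector f v) (hg : IsKernelVector g v) : IsKernelVector (wedge f g) v := by
  rintro m ⟨i, hi⟩
  simp only [StableHamiltonian.wedge, AlternatingMap.domDomCongr_apply,
    LinearMap.compAlternatingMap_apply, AlternatingMap.domCoprod_apply, sum_apply, map_sum]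
  refine Finset.sum_eq_zero fun σ _ ↦ ?_
  induction σ using Quotient.inductionOn' with
  | h σ =>
    simp only [AlternatingMap.domCoprod.summand_mk'', smul_apply,
      MultilinearMap.domDomCongr_apply, MultilinearMap.domCoprod_apply]
    rw [map_zsmul_unit]
    rcases hj : σ.symm (finSumFinEquiv.symm i) with j | j
    · have hfm : f (fun x ↦ m (finSumFinEquiv (σ (Sum.inl x)))) = 0 :=
        hf _ ⟨j, by simp [← hj, hi]⟩
      simp [hfm]
    · have hgm : g (fun x ↦ m (finSumFinEquiv (σ (Sum.inr x)))) = 0 :=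
        hg _ ⟨j, by simp [← hj, hi]⟩
      simp [hgm]

theorem IsKernelVector.wedge_wedgePow {k : ℕ} {f : V [⋀^Fin k]→ₗ[ℝ] ℝ}
    {β : V [⋀^Fin 2]→ₗ[ℝ] ℝ} (hf : IsKernelVector f v) (hβ : IsKernelVector β v) (l : ℕ) :
    IsKernelVector (StableHamiltonian.wedge f (wedgePow β l)) v := by
  suffices IsKernelVector (wedgePow β l) v from hf.wedge this
  induction l with
  | zero => exact fun _ ⟨i, _⟩ ↦ i.elim0
  | succ l ih => exact ih.wedge hβ

variable [FiniteDimensional ℝ V] {d : ℕ} {a : V [⋀^Fin 1]→ₗ[ℝ] ℝ} {β : V [⋀^Fin 2]→ₗ[ℝ] ℝ}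

theorem eq_zero_of_wedge_wedgePow_ne_zero (hV : Module.finrank ℝ V = 2 * d + 1)
    (h : wedge a (wedgePow β d) ≠ 0) (hβ : ∀ w, β ![v, w] = 0) (ha : a ![v] = 0) : v = 0 :=
  IsKernelVector.eq_zero (hV.trans (add_comm _ _)) h <|
    (isKernelVector_of_apply_single_eq_zero ha).wedge_wedgePow
      (isKernelVector_of_apply_pair_eq_zero hβ) d

theorem exists_reeb_vector (hV : Module.finrank ℝ V = 2 * d + 1)
    (h : wedge a (wedgePow β d) ≠ 0) : ∃ v, (∀ w, β ![v, w] = 0) ∧ a ![v] = 1 := by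
  obtain ⟨v, hv, hβ⟩ := exists_ne_zero_apply_eq_zero_of_odd_finrank ⟨d, hV⟩ (isAlt_toBilin β)
  have ha : a ![v] ≠ 0 := fun ha ↦ hv (eq_zero_of_wedge_wedgePow_ne_zero hV h hβ ha)
  refine ⟨(a ![v])⁻¹ • v, fun w ↦ ?_, ?_⟩
  · rw [β.map_vecCons_smul, ← toBilin_apply, hβ, smul_zero]
  · rw [a.map_vecCons_smul, smul_eq_mul, inv_mul_cancel₀ ha]

theorem reeb_vector_unique (hV : Module.finrank ℝ V = 2 * d + 1)
    (h : wedge a (wedgePow β d) ≠ 0) {v' : V} (hv : (∀ w, β ![v, w] = 0) ∧ a ![v] = 1)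
    (hv' : (∀ w, β ![v', w] = 0) ∧ a ![v'] = 1) : v = v' := by
  refine sub_eq_zero.1 (eq_zero_of_wedge_wedgePow_ne_zero hV h (fun w ↦ ?_) ?_)
  · rw [← toBilin_apply, map_sub, LinearMap.sub_apply, toBilin_apply, toBilin_apply, hv.1, hv'.1,
      sub_zero]
  · rw [apply_single_sub, hv.2, hv'.2, sub_self]

theorem exists_apply_pair_ne_zero (hV : Module.finrank ℝ V = 2 * d + 1) (hd : 0 < d)
    (h : wedge a (wedgePow β d) ≠ 0) : ∃ u w, β ![u, w] ≠ 0 := by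
  by_contra! hβ
  let l : V →ₗ[ℝ] ℝ := (AlternatingMap.ofSubsingleton ℝ V ℝ (0 : Fin 1)).symm a
  have hker : LinearMap.ker l ≠ ⊥ := LinearMap.ker_ne_bot_of_finrank_lt <| by
    rw [hV, Module.finrank_self]
    lia
  obtain ⟨v, hv, hv0⟩ := (Submodule.ne_bot_iff _).1 hker
  have hav : a ![v] = l v := congrArg a (funext fun i ↦ Matrix.cons_val_fin_one v ![] i)
  exact hv0 (eq_zero_of_wedge_wedgePow_ne_zero hV h (hβ v) (hav.trans hv))

end WedgePowers

section Christoffel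

variable {F : Type*} [NormedAddCommGroup F] [NormedSpace ℝ F]
variable {β : F →L[ℝ] F →L[ℝ] ℝ} {a : F →L[ℝ] ℝ} {D T : F →L[ℝ] F →L[ℝ] F →L[ℝ] ℝ}
variable {e : F} {A : F →L[ℝ] F} {G : F →L[ℝ] F →L[ℝ] F} {P : (F →L[ℝ] ℝ) →L[ℝ] F}

/-- The bilinear form `β + a ⊗ a`, as a map to the dual. When `β` is a 2-form whose kernel meets
that of `a` trivially, it is invertible, and so it replaces the inverse of a symplectic form. -/
def pairing (β : F →L[ℝ] F →L[ℝ] ℝ) (a : F →L[ℝ] ℝ) : F →L[ℝ] F →L[ℝ] ℝ :=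
  β + a.smulRight a

theorem pairing_apply (β : F →L[ℝ] F →L[ℝ] ℝ) (a : F →L[ℝ] ℝ) (u v : F) :
    pairing β a u v = β u v + a u * a v := rfl

theorem injective_pairing (hβ : ∀ u v, β u v = -β v u) (h : ∀ v, β v = 0 → a v = 0 → v = 0) :
    Function.Injective (pairing β a) := by
  refine (injective_iff_map_eq_zero _).2 fun v hv ↦ ?_
  have hvw (w : F) : β v w + a v * a w = 0 := by rw [← pairing_apply, hv, zero_apply]
  have hav : a v = 0 := by
    have hβv : β v v = 0 := self_eq_neg.1 (hβ v v)
    simpa [hβv] using hvw v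
  exact h v (by ext w; simpa [hav] using hvw w) hav

theorem isInvertible_pairing [FiniteDimensional ℝ F] (hβ : ∀ u v, β u v = -β v u)
    (h : ∀ v, β v = 0 → a v = 0 → v = 0) : (pairing β a).IsInvertible := by
  have hfin : Module.finrank ℝ F = Module.finrank ℝ (F →L[ℝ] ℝ) :=
    Subspace.dual_finrank_eq.symm.trans LinearMap.toContinuousLinearMap.finrank_eq
  exact ⟨(LinearEquiv.ofInjectiveOfFinrankEq (pairing β a : F →ₗ[ℝ] F →L[ℝ] ℝ)
    (injective_pairing hβ h) hfin).toContinuousLinearEquiv, rfl⟩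

theorem inverse_pairing_apply (h : (pairing β a).IsInvertible) (he : β e = 0) (hae : a e = 1) :
    (pairing β a).inverse a = e := by
  rw [h.inverse_apply_eq]
  ext w
  simp [pairing_apply, he, hae]

/-- The symmetric correction `-(a ⊗ A + A ⊗ a) + a ⊗ a ⊗ A e` of the trivial connection, which
makes `e` parallel when `A` is the derivative of `e`. -/
def fieldCorrection (a : F →L[ℝ] ℝ) (A : F →L[ℝ] F) (e : F) : F →L[ℝ] F →L[ℝ] F :=
  -(a.smulRight A + (a.smulRight A).flip) + a.smulRight (a.smulRight (A e))

theorem fieldCorrection_apply (a : F →L[ℝ] ℝ) (A : F →L[ℝ] F) (e u v : F) :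
    fieldCorrection a A e u v = -(a u • A v + a v • A u) + a u • a v • A e := rfl

theorem fieldCorrection_comm (a : F →L[ℝ] ℝ) (A : F →L[ℝ] F) (e u v : F) :
    fieldCorrection a A e u v = fieldCorrection a A e v u := by
  simp only [fieldCorrection_apply]
  module

theorem add_fieldCorrection_apply (hae : a e = 1) (A : F →L[ℝ] F) (u : F) :
    A u + fieldCorrection a A e u e = 0 := by
  simp only [fieldCorrection_apply, hae]
  module

/-- The covariant derivative `D u v w - β (G u v) w - β v (G u w)` of the 2-form `β` for the
connection with Christoffel tensor `G`, where `D` is the derivative of `β`. The last term is encoded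
as `β (G u w) v`, using that `β` is skew-symmetric. -/
def formDefect (D : F →L[ℝ] F →L[ℝ] F →L[ℝ] ℝ) (β : F →L[ℝ] F →L[ℝ] ℝ)
    (G : F →L[ℝ] F →L[ℝ] F) : F →L[ℝ] F →L[ℝ] F →L[ℝ] ℝ :=
  D - (ContinuousLinearMap.compL ℝ F F (F →L[ℝ] ℝ) β).comp G +
    (ContinuousLinearMap.flipₗᵢ ℝ F F ℝ : (F →L[ℝ] F →L[ℝ] ℝ) →L[ℝ] (F →L[ℝ] F →L[ℝ] ℝ)).comp
      ((ContinuousLinearMap.compL ℝ F F (F →L[ℝ] ℝ) β).comp G)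

theorem formDefect_apply (D : F →L[ℝ] F →L[ℝ] F →L[ℝ] ℝ) (β : F →L[ℝ] F →L[ℝ] ℝ)
    (G : F →L[ℝ] F →L[ℝ] F) (u v w : F) :
    formDefect D β G u v w = D u v w - β (G u v) w + β (G u w) v := rfl

theorem formDefect_swap (hD : ∀ u v w, D u v w = -D u w v) (u v w : F) :
    formDefect D β G u v w = -formDefect D β G u w v := by
  rw [formDefect_apply, formDefect_apply, hD u v w]
  ring

theorem formDefect_cyclic (hD : ∀ u v w, D u v w + D v w u + D w u v = 0)
    (hG : ∀ u v, G u v = G v u) (u v w : F) :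
    formDefect D β G u v w + formDefect D β G v w u + formDefect D β G w u v = 0 := by
  simp only [formDefect_apply]
  rw [hG v u, hG w u, hG w v]
  linear_combination hD u v w

/-- The tensor `(P (T (u, v, ·)) + P (T (v, u, ·))) / 3`. If `P` inverts a 2-form, adding it to a
Christoffel tensor for which `T` is the covariant derivative of the 2-form makes the latter
parallel. -/
def formCorrection (P : (F →L[ℝ] ℝ) →L[ℝ] F) (T : F →L[ℝ] F →L[ℝ] F →L[ℝ] ℝ) :
    F →L[ℝ] F →L[ℝ] F :=
  (1 / 3 : ℝ) • ((ContinuousLinearMap.compL ℝ F (F →L[ℝ] ℝ) F P).comp T +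
    ((ContinuousLinearMap.compL ℝ F (F →L[ℝ] ℝ) F P).comp T).flip)

theorem formCorrection_apply (P : (F →L[ℝ] ℝ) →L[ℝ] F) (T : F →L[ℝ] F →L[ℝ] F →L[ℝ] ℝ)
    (u v : F) : formCorrection P T u v = (1 / 3 : ℝ) • (P (T u v) + P (T v u)) := rfl

theorem formCorrection_comm (P : (F →L[ℝ] ℝ) →L[ℝ] F) (T : F →L[ℝ] F →L[ℝ] F →L[ℝ] ℝ)
    (u v : F) : formCorrection P T u v = formCorrection P T v u := by
  rw [formCorrection_apply, formCorrection_apply, add_comm]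

theorem apply_formCorrection (hβ : ∀ u v, β u v = -β v u) (hT : ∀ u v w, T u v w = -T u w v)
    (hcyc : ∀ u v w, T u v w + T v w u + T w u v = 0)
    (hP : ∀ u v w, β (P (T u v)) w = T u v w) (u v w : F) :
    β (formCorrection P T u v) w + β v (formCorrection P T u w) = T u v w := by
  have hcorr (u v w : F) : β (formCorrection P T u v) w = 1 / 3 * (T u v w + T v u w) := by
    rw [formCorrection_apply, map_smul, map_add, smul_apply, add_apply, hP, hP, smul_eq_mul]
  rw [hβ v, hcorr, hcorr]
  linear_combination (1 / 3 : ℝ) * (-hcyc u v w - hT u w v + hT v w u)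

theorem apply_inverse_pairing (hβ : ∀ u v, β u v = -β v u) (hP : (pairing β a).IsInvertible)
    (he : β e = 0) (hae : a e = 1) {l : F →L[ℝ] ℝ} (hl : l e = 0) :
    β ((pairing β a).inverse l) = l := by
  set v := (pairing β a).inverse l
  have hv : pairing β a v = l := hP.self_apply_inverse l
  have hav : a v = 0 := by
    simpa [pairing_apply, hβ v e, he, hae, hl] using DFunLike.congr_fun hv e
  ext w
  simpa [pairing_apply, hav] using DFunLike.congr_fun hv w

/-- The vector `e` is the value, and `A` the derivative, at a point of a vector field in the kernel
of a closed 2-form whose value and derivative at that point are `β` and `D`. -/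
structure IsKernelJet (β : F →L[ℝ] F →L[ℝ] ℝ) (D : F →L[ℝ] F →L[ℝ] F →L[ℝ] ℝ) (e : F)
    (A : F →L[ℝ] F) : Prop where
  form_swap : ∀ u v, β u v = -β v u
  deriv_swap : ∀ u v w, D u v w = -D u w v
  deriv_cyclic : ∀ u v w, D u v w + D v w u + D w u v = 0
  form_apply : β e = 0
  deriv_apply : ∀ u w, D u e w + β (A u) w = 0

/-- The tensor `Γ` is the Christoffel tensor at a point of a torsion-free connection for which a
2-form and a vector field, with values `β` and `e` and derivatives `D` and `A`, are parallel. -/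
structure IsShsChristoffel (β : F →L[ℝ] F →L[ℝ] ℝ) (D : F →L[ℝ] F →L[ℝ] F →L[ℝ] ℝ) (e : F)
    (A : F →L[ℝ] F) (Γ : F →L[ℝ] F →L[ℝ] F) : Prop where
  comm : ∀ u v, Γ u v = Γ v u
  parallel_field : ∀ u, A u + Γ u e = 0
  parallel_form : ∀ u v w, D u v w = β (Γ u v) w + β v (Γ u w)

theorem IsKernelJet.apply_self (h : IsKernelJet β D e A) (u : F) : β u e = 0 := by
  rw [h.form_swap, h.form_apply, zero_apply, neg_zero]

theorem IsKernelJet.formDefect_apply_right (h : IsKernelJet β D e A)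
    (hG : ∀ u, A u + G u e = 0) (u : F) : formDefect D β G u e = 0 := by
  ext w
  rw [formDefect_apply, h.apply_self, ← neg_eq_iff_add_eq_zero.2 (hG u), map_neg, neg_apply,
    zero_apply]
  linear_combination h.deriv_apply u w

theorem IsKernelJet.formDefect_apply_left (h : IsKernelJet β D e A) (hGcomm : ∀ u v, G u v = G v u)
    (hG : ∀ u, A u + G u e = 0) (u : F) : formDefect D β G e u = 0 := by
  ext w
  have hcyc := formDefect_cyclic (β := β) h.deriv_cyclic hGcomm e u w
  rw [h.formDefect_apply_right hG w, formDefect_swap h.deriv_swap u w e,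
    h.formDefect_apply_right hG u] at hcyc
  simpa using hcyc

/-- The Christoffel tensor obtained from the trivial connection by first making the vector field
parallel and then the 2-form. -/
def shsChristoffel (β : F →L[ℝ] F →L[ℝ] ℝ) (a : F →L[ℝ] ℝ) (D : F →L[ℝ] F →L[ℝ] F →L[ℝ] ℝ) (e : F)
    (A : F →L[ℝ] F) : F →L[ℝ] F →L[ℝ] F :=
  fieldCorrection a A e +
    formCorrection (pairing β a).inverse (formDefect D β (fieldCorrection a A e))

theorem IsKernelJet.isShsChristoffel (h : IsKernelJet β D e A) (hP : (pairing β a).IsInvertible)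
    (hae : a e = 1) : IsShsChristoffel β D e A (shsChristoffel β a D e A) := by
  set G := fieldCorrection a A e with hG
  set T := formDefect D β G with hT
  have hGcomm : ∀ u v, G u v = G v u := fieldCorrection_comm a A e
  have hGe : ∀ u, A u + G u e = 0 := add_fieldCorrection_apply hae A
  have hswap : ∀ u v w, T u v w = -T u w v := formDefect_swap h.deriv_swap
  have hTe : ∀ u, T u e = 0 := h.formDefect_apply_right hGe
  have hβP (u v w : F) : β ((pairing β a).inverse (T u v)) w = T u v w := by
    rw [apply_inverse_pairing h.form_swap hP h.form_apply hae]
    rw [hswap, hTe, zero_apply, neg_zero]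
  refine ⟨fun u v ↦ ?_, fun u ↦ ?_, fun u v w ↦ ?_⟩ <;>
    simp only [shsChristoffel, ← hG, ← hT, add_apply, map_add]
  · rw [hGcomm, formCorrection_comm]
  · rw [formCorrection_apply, hTe, h.formDefect_apply_left hGcomm hGe, map_zero, add_zero,
      smul_zero, add_zero, hGe]
  · have hcorr := apply_formCorrection h.form_swap hswap (formDefect_cyclic h.deriv_cyclic hGcomm)
      hβP u v w
    rw [h.form_swap v (G u w)]
    linear_combination -hcorr - formDefect_apply D β G u v w

end Christoffel

section ChristoffelSmooth

variable {X F : Type*} [NormedAddCommGroup X] [NormedSpace ℝ X] [NormedAddCommGroup F]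
  [NormedSpace ℝ F] {H K : Type*} [NormedAddCommGroup H] [NormedSpace ℝ H] [NormedAddCommGroup K]
  [NormedSpace ℝ K] {n : WithTop ℕ∞} {s : Set X}
variable {β : X → F →L[ℝ] F →L[ℝ] ℝ} {a : X → F →L[ℝ] ℝ} {D : X → F →L[ℝ] F →L[ℝ] F →L[ℝ] ℝ}
variable {e : X → F} {A : X → F →L[ℝ] F} {G : X → F →L[ℝ] F →L[ℝ] F}

theorem contDiffOn_inverse_pairing [CompleteSpace F] (hβ : ContDiffOn ℝ n β s)
    (ha : ContDiffOn ℝ n a s) (h : ∀ y ∈ s, (pairing (β y) (a y)).IsInvertible) :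
    ContDiffOn ℝ n (fun y ↦ (pairing (β y) (a y)).inverse) s := fun y hy ↦
  (h y hy).contDiffAt_map_inverse.comp_contDiffWithinAt (f := fun y ↦ pairing (β y) (a y)) y <|
    (hβ y hy).add ((ha y hy).smulRight (ha y hy))

theorem contDiffOn_of_pairing [CompleteSpace F] (hβ : ContDiffOn ℝ n β s) (ha : ContDiffOn ℝ n a s)
    (h : ∀ y ∈ s, (pairing (β y) (a y)).IsInvertible)
    (he : ∀ y ∈ s, β y (e y) = 0) (hae : ∀ y ∈ s, a y (e y) = 1) : ContDiffOn ℝ n e s :=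
  ((contDiffOn_inverse_pairing hβ ha h).clm_apply ha).congr fun y hy ↦
    (inverse_pairing_apply (h y hy) (he y hy) (hae y hy)).symm

theorem contDiffOn_flip {C : X → F →L[ℝ] F →L[ℝ] H} (hC : ContDiffOn ℝ n C s) :
    ContDiffOn ℝ n (fun y ↦ (C y).flip) s :=
  (ContinuousLinearMap.flipₗᵢ ℝ F F H).contDiff.comp_contDiffOn hC

theorem contDiffOn_compL_comp {L : X → K →L[ℝ] H} {C : X → F →L[ℝ] F →L[ℝ] K}
    (hL : ContDiffOn ℝ n L s) (hC : ContDiffOn ℝ n C s) :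
    ContDiffOn ℝ n (fun y ↦ (ContinuousLinearMap.compL ℝ F K H (L y)).comp (C y)) s :=
  ((ContinuousLinearMap.compL ℝ F K H).contDiff.comp_contDiffOn hL).clm_comp hC

theorem contDiffOn_fieldCorrection (ha : ContDiffOn ℝ n a s) (hA : ContDiffOn ℝ n A s)
    (he : ContDiffOn ℝ n e s) : ContDiffOn ℝ n (fun y ↦ fieldCorrection (a y) (A y) (e y)) s :=
  ((ha.smulRight hA).add (contDiffOn_flip (ha.smulRight hA))).neg.add
    (ha.smulRight (ha.smulRight (hA.clm_apply he)))

theorem contDiffOn_formDefect (hD : ContDiffOn ℝ n D s) (hβ : ContDiffOn ℝ n β s)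
    (hG : ContDiffOn ℝ n G s) : ContDiffOn ℝ n (fun y ↦ formDefect (D y) (β y) (G y)) s :=
  have hβG := contDiffOn_compL_comp hβ hG
  (hD.sub hβG).add (contDiff_const.contDiffOn.clm_comp hβG)

theorem contDiffOn_formCorrection {P : X → (F →L[ℝ] ℝ) →L[ℝ] F} (hP : ContDiffOn ℝ n P s)
    (hD : ContDiffOn ℝ n D s) : ContDiffOn ℝ n (fun y ↦ formCorrection (P y) (D y)) s :=
  have hPD := contDiffOn_compL_comp hP hD
  (hPD.add (contDiffOn_flip hPD)).const_smul (1 / 3 : ℝ)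

theorem contDiffOn_shsChristoffel [CompleteSpace F] (hβ : ContDiffOn ℝ n β s)
    (ha : ContDiffOn ℝ n a s) (hD : ContDiffOn ℝ n D s) (he : ContDiffOn ℝ n e s)
    (hA : ContDiffOn ℝ n A s)
    (h : ∀ y ∈ s, (pairing (β y) (a y)).IsInvertible) :
    ContDiffOn ℝ n (fun y ↦ shsChristoffel (β y) (a y) (D y) (e y) (A y)) s :=
  have hG := contDiffOn_fieldCorrection ha hA he
  hG.add <| contDiffOn_formCorrection (contDiffOn_inverse_pairing hβ ha h)
    (contDiffOn_formDefect hD hβ hG)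

end ChristoffelSmooth

section LocalSolution

variable {F : Type*} [NormedAddCommGroup F] [NormedSpace ℝ F] {β : F → F →L[ℝ] F →L[ℝ] ℝ}
  {e : F → F} {y : F}

theorem fderiv_clm_apply₂ (hβ : DifferentiableAt ℝ β y) (u v w : F) :
    fderiv ℝ β y u v w = fderiv ℝ (fun z ↦ β z v w) y u := by
  have hasFDeriv := (hβ.hasFDerivAt.clm_apply (hasFDerivAt_const v y)).clm_apply
    (hasFDerivAt_const w y)
  rw [hasFDeriv.fderiv]
  simp

theorem isKernelJet_fderiv (hβ : DifferentiableAt ℝ β y) (he : DifferentiableAt ℝ e y)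
    (hswap : ∀ z u v, β z u v = -β z v u)
    (hcyc : ∀ u v w, fderiv ℝ β y u v w + fderiv ℝ β y v w u + fderiv ℝ β y w u v = 0)
    (hβe : ∀ᶠ z in nhds y, β z (e z) = 0) :
    IsKernelJet (β y) (fderiv ℝ β y) (e y) (fderiv ℝ e y) where
  form_swap := hswap y
  deriv_swap u v w := by
    rw [fderiv_clm_apply₂ hβ, fderiv_clm_apply₂ hβ, funext fun z ↦ hswap z v w, fderiv_fun_neg,
      neg_apply]
  deriv_cyclic := hcyc
  form_apply := hβe.self_of_nhds
  deriv_apply u w := by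
    have hzero : fderiv ℝ (fun z ↦ β z (e z)) y = 0 :=
      (Filter.EventuallyEq.fderiv_eq hβe).trans (congrFun (fderiv_fun_const _) y)
    rw [(hβ.hasFDerivAt.clm_apply he.hasFDerivAt).fderiv] at hzero
    simpa [add_comm] using DFunLike.congr_fun (DFunLike.congr_fun hzero u) w

theorem exists_contDiffOn_isShsChristoffel [CompleteSpace F] {s : Set F} (hs : IsOpen s)
    {a : F → F →L[ℝ] ℝ} (hβ : ContDiffOn ℝ ∞ β s) (ha : ContDiffOn ℝ ∞ a s)
    (he : ContDiffOn ℝ ∞ e s) (hP : ∀ y ∈ s, (pairing (β y) (a y)).IsInvertible)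
    (hswap : ∀ y u v, β y u v = -β y v u)
    (hcyc : ∀ y ∈ s, ∀ u v w,
      fderiv ℝ β y u v w + fderiv ℝ β y v w u + fderiv ℝ β y w u v = 0)
    (hβe : ∀ y ∈ s, β y (e y) = 0) (hae : ∀ y ∈ s, a y (e y) = 1) :
    ∃ Γ : F → F →L[ℝ] F →L[ℝ] F, ContDiffOn ℝ ∞ Γ s ∧
      ∀ y ∈ s, IsShsChristoffel (β y) (fderiv ℝ β y) (e y) (fderiv ℝ e y) (Γ y) := by
  refine ⟨_, contDiffOn_shsChristoffel hβ ha (hβ.fderiv_of_isOpen hs (by simp)) he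
    (he.fderiv_of_isOpen hs (by simp)) hP, fun y hy ↦ ?_⟩
  have hsy : s ∈ nhds y := hs.mem_nhds hy
  exact (isKernelJet_fderiv ((hβ.contDiffAt hsy).differentiableAt (by simp))
    ((he.contDiffAt hsy).differentiableAt (by simp)) hswap (hcyc y hy)
    (Filter.mem_of_superset hsy hβe)).isShsChristoffel (hP y hy) (hae y hy)

end LocalSolution

section Charts

open Set Topology VectorField

variable {E : Type*} [NormedAddCommGroup E] [NormedSpace ℝ E]
  {M : Type*} [TopologicalSpace M] [ChartedSpace E M] {x₀ x : M}

theorem mem_chartAt_source (hx : x ∈ (extChartAt 𝓘(ℝ, E) x₀).source) : x ∈ (chartAt E x₀).source :=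
  extChartAt_source 𝓘(ℝ, E) x₀ ▸ hx

theorem extChartAt_target_mem_nhds_of_mem_source (hx : x ∈ (extChartAt 𝓘(ℝ, E) x₀).source) :
    (extChartAt 𝓘(ℝ, E) x₀).target ∈ 𝓝 (extChartAt 𝓘(ℝ, E) x₀ x) :=
  (isOpen_extChartAt_target x₀).mem_nhds ((extChartAt 𝓘(ℝ, E) x₀).map_source hx)

section Functions

variable {G : Type*} [NormedAddCommGroup G] [NormedSpace ℝ G] {g : M → G} {h : E → G}

theorem contMDiffAt_iff_contDiffAt_of_eqOn {n : ℕ∞ω} [IsManifold 𝓘(ℝ, E) n M]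
    (hx : x ∈ (extChartAt 𝓘(ℝ, E) x₀).source)
    (hg : EqOn (g ∘ (extChartAt 𝓘(ℝ, E) x₀).symm) h (extChartAt 𝓘(ℝ, E) x₀).target) :
    CMDiffAt n g x ↔ ContDiffAt ℝ n h (extChartAt 𝓘(ℝ, E) x₀ x) := by
  rw [contMDiffAt_iff_source_of_mem_source (mem_chartAt_source hx), modelWithCornersSelf_coe,
    range_id, contMDiffWithinAt_univ, contMDiffAt_iff_contDiffAt]
  have hgh := hg.eventuallyEq_of_mem (extChartAt_target_mem_nhds_of_mem_source hx)
  exact ⟨fun H ↦ H.congr_of_eventuallyEq (Filter.EventuallyEq.symm hgh),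
    fun H ↦ H.congr_of_eventuallyEq hgh⟩

theorem mdifferentiableAt_iff_differentiableAt_of_eqOn [IsManifold 𝓘(ℝ, E) 1 M]
    (hx : x ∈ (extChartAt 𝓘(ℝ, E) x₀).source)
    (hg : EqOn (g ∘ (extChartAt 𝓘(ℝ, E) x₀).symm) h (extChartAt 𝓘(ℝ, E) x₀).target) :
    MDiffAt g x ↔ DifferentiableAt ℝ h (extChartAt 𝓘(ℝ, E) x₀ x) := by
  rw [mdifferentiableAt_iff_source_of_mem_source (mem_chartAt_source hx), modelWithCornersSelf_coe,
    range_id, mdifferentiableWithinAt_univ, mdifferentiableAt_iff_differentiableAt]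
  exact Filter.EventuallyEq.differentiableAt_iff <|
    hg.eventuallyEq_of_mem (extChartAt_target_mem_nhds_of_mem_source hx)

end Functions

variable [IsManifold 𝓘(ℝ, E) ∞ M]

/-- The derivative at `x` of the preferred chart at `x₀`, as a map to the model space. -/
def chartD (x₀ x : M) : TangentSpace 𝓘(ℝ, E) x →L[ℝ] E :=
  (trivializationAt E (TangentSpace 𝓘(ℝ, E)) x₀).continuousLinearMapAt ℝ x

/-- The inverse of `chartD x₀ x`. -/
def chartDInv (x₀ x : M) : E →L[ℝ] TangentSpace 𝓘(ℝ, E) x :=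
  (trivializationAt E (TangentSpace 𝓘(ℝ, E)) x₀).symmL ℝ x

/-- The expression of a vector field in the preferred chart at `x₀`. -/
def chartField (x₀ : M) (σ : ∀ x : M, TangentSpace 𝓘(ℝ, E) x) (y : E) : E :=
  chartD x₀ ((extChartAt 𝓘(ℝ, E) x₀).symm y) (σ ((extChartAt 𝓘(ℝ, E) x₀).symm y))

theorem chartDInv_chartD (hx : x ∈ (extChartAt 𝓘(ℝ, E) x₀).source)
    (v : TangentSpace 𝓘(ℝ, E) x) : chartDInv x₀ x (chartD x₀ x v) = v :=
  Trivialization.symmL_continuousLinearMapAt _ (mem_chartAt_source hx) v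

theorem chartD_chartDInv (hx : x ∈ (extChartAt 𝓘(ℝ, E) x₀).source) (v : E) :
    chartD x₀ x (chartDInv x₀ x v) = v :=
  Trivialization.continuousLinearMapAt_symmL _ (mem_chartAt_source hx) v

theorem chartD_injective (hx : x ∈ (extChartAt 𝓘(ℝ, E) x₀).source) :
    Function.Injective (chartD (E := E) x₀ x) :=
  Function.LeftInverse.injective (chartDInv_chartD hx)

theorem chartD_eq_mfderiv (hx : x ∈ (extChartAt 𝓘(ℝ, E) x₀).source) :
    chartD x₀ x = mfderiv% (extChartAt 𝓘(ℝ, E) x₀) x :=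
  TangentBundle.continuousLinearMapAt_trivializationAt (mem_chartAt_source hx)

theorem mfderiv_extChartAt_symm_apply {y : E} (hy : y ∈ (extChartAt 𝓘(ℝ, E) x₀).target) (v : E) :
    mfderiv% (extChartAt 𝓘(ℝ, E) x₀).symm y v =
      chartDInv x₀ ((extChartAt 𝓘(ℝ, E) x₀).symm y) v := by
  have hx := (extChartAt 𝓘(ℝ, E) x₀).map_target hy
  have hcomp := mfderiv_extChartAt_comp_mfderivWithin_extChartAt_symm hy
  rw [modelWithCornersSelf_coe, range_id, mfderivWithin_univ] at hcomp
  apply chartD_injective hx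
  rw [chartD_chartDInv hx, chartD_eq_mfderiv hx]
  exact DFunLike.congr_fun hcomp v

theorem chartField_extChartAt (hx : x ∈ (extChartAt 𝓘(ℝ, E) x₀).source)
    (σ : ∀ x : M, TangentSpace 𝓘(ℝ, E) x) :
    chartField x₀ σ (extChartAt 𝓘(ℝ, E) x₀ x) = chartD x₀ x (σ x) := by
  rw [chartField, (extChartAt 𝓘(ℝ, E) x₀).left_inv hx]

theorem trivializationAt_snd (hx : x ∈ (extChartAt 𝓘(ℝ, E) x₀).source)
    (v : TangentSpace 𝓘(ℝ, E) x) :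
    (trivializationAt E (TangentSpace 𝓘(ℝ, E)) x₀ ⟨x, v⟩).2 = chartD x₀ x v := by
  rw [chartD, Trivialization.continuousLinearMapAt_apply,
    Trivialization.coe_linearMapAt_of_mem _ (mem_chartAt_source hx)]

theorem mpullback_extChartAt_symm (σ : ∀ x : M, TangentSpace 𝓘(ℝ, E) x) {y : E}
    (hy : y ∈ (extChartAt 𝓘(ℝ, E) x₀).target) :
    mpullback 𝓘(ℝ, E) 𝓘(ℝ, E) (extChartAt 𝓘(ℝ, E) x₀).symm σ y = chartField x₀ σ y := by
  have hinv : (mfderiv% (extChartAt 𝓘(ℝ, E) x₀).symm y).IsInvertible := by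
    simpa using isInvertible_mfderivWithin_extChartAt_symm (I := 𝓘(ℝ, E)) hy
  refine hinv.inverse_apply_eq.2 ((mfderiv_extChartAt_symm_apply hy _).trans ?_).symm
  exact chartDInv_chartD ((extChartAt 𝓘(ℝ, E) x₀).map_target hy) _

theorem mfderiv_of_eqOn {G : Type*} [NormedAddCommGroup G] [NormedSpace ℝ G] {g : M → G} {h : E → G}
    (hx : x ∈ (extChartAt 𝓘(ℝ, E) x₀).source)
    (hg : EqOn (g ∘ (extChartAt 𝓘(ℝ, E) x₀).symm) h (extChartAt 𝓘(ℝ, E) x₀).target)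
    (hh : DifferentiableAt ℝ h (extChartAt 𝓘(ℝ, E) x₀ x)) (u : TangentSpace 𝓘(ℝ, E) x) :
    mfderiv% g x u = fderiv ℝ h (extChartAt 𝓘(ℝ, E) x₀ x) (chartD x₀ x u) := by
  have hgh : g =ᶠ[𝓝 x] h ∘ extChartAt 𝓘(ℝ, E) x₀ := by
    filter_upwards [extChartAt_source_mem_nhds' hx] with z hz
    rw [Function.comp_apply, ← hg ((extChartAt 𝓘(ℝ, E) x₀).map_source hz), Function.comp_apply,
      (extChartAt 𝓘(ℝ, E) x₀).left_inv hz]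
  have hcomp := hh.hasFDerivAt.hasMFDerivAt.comp x
    (mdifferentiableAt_extChartAt (I := 𝓘(ℝ, E)) (mem_chartAt_source hx)).hasMFDerivAt
  rw [chartD_eq_mfderiv hx, (hcomp.congr_of_eventuallyEq hgh).mfderiv]
  rfl

section Sections

variable {σ : ∀ x : M, TangentSpace 𝓘(ℝ, E) x}

theorem eqOn_chartField (x₀ : M) (σ : ∀ x : M, TangentSpace 𝓘(ℝ, E) x) :
    EqOn ((fun z ↦ (trivializationAt E (TangentSpace 𝓘(ℝ, E)) x₀ ⟨z, σ z⟩).2) ∘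
      (extChartAt 𝓘(ℝ, E) x₀).symm) (chartField x₀ σ) (extChartAt 𝓘(ℝ, E) x₀).target :=
  fun _ hy ↦ trivializationAt_snd ((extChartAt 𝓘(ℝ, E) x₀).map_target hy) _

theorem contMDiffAt_iff_contDiffAt_chartField (hx : x ∈ (extChartAt 𝓘(ℝ, E) x₀).source) :
    CMDiffAt ∞ (T% σ) x ↔ ContDiffAt ℝ ∞ (chartField x₀ σ) (extChartAt 𝓘(ℝ, E) x₀ x) :=
  ((trivializationAt E (TangentSpace 𝓘(ℝ, E)) x₀).contMDiffAt_section_iff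
    (mem_chartAt_source hx)).trans (contMDiffAt_iff_contDiffAt_of_eqOn hx (eqOn_chartField x₀ σ))

theorem mdifferentiableAt_iff_differentiableAt_chartField
    (hx : x ∈ (extChartAt 𝓘(ℝ, E) x₀).source) :
    MDiffAt (T% σ) x ↔ DifferentiableAt ℝ (chartField x₀ σ) (extChartAt 𝓘(ℝ, E) x₀ x) :=
  ((trivializationAt E (TangentSpace 𝓘(ℝ, E)) x₀).mdifferentiableAt_section_iff 𝓘(ℝ, E) σ
    (mem_chartAt_source hx)).trans
      (mdifferentiableAt_iff_differentiableAt_of_eqOn hx (eqOn_chartField x₀ σ))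

theorem contMDiffAt_endomorphism_iff
    {A : ∀ x : M, TangentSpace 𝓘(ℝ, E) x →L[ℝ] TangentSpace 𝓘(ℝ, E) x} {B : E → E →L[ℝ] E}
    (hx : x ∈ (extChartAt 𝓘(ℝ, E) x₀).source)
    (hA : ∀ z ∈ (extChartAt 𝓘(ℝ, E) x₀).source, ∀ u,
      chartD x₀ z (A z u) = B (extChartAt 𝓘(ℝ, E) x₀ z) (chartD x₀ z u)) :
    ContMDiffAt 𝓘(ℝ, E) (𝓘(ℝ, E).prod 𝓘(ℝ, E →L[ℝ] E)) ∞
      (fun z ↦ (⟨z, A z⟩ : TotalSpace (E →L[ℝ] E)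
        fun z : M ↦ TangentSpace 𝓘(ℝ, E) z →L[ℝ] TangentSpace 𝓘(ℝ, E) z)) x ↔
      ContDiffAt ℝ ∞ B (extChartAt 𝓘(ℝ, E) x₀ x) := by
  refine ((trivializationAt (E →L[ℝ] E)
    (fun z : M ↦ TangentSpace 𝓘(ℝ, E) z →L[ℝ] TangentSpace 𝓘(ℝ, E) z)
      x₀).contMDiffAt_section_iff ?_).trans
        (contMDiffAt_iff_contDiffAt_of_eqOn hx fun y hy ↦ ?_)
  · rw [hom_trivializationAt_baseSet]
    exact ⟨mem_chartAt_source hx, mem_chartAt_source hx⟩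
  · have hz := (extChartAt 𝓘(ℝ, E) x₀).map_target hy
    rw [Function.comp_apply, hom_trivializationAt_apply]
    ext u
    change chartD x₀ _ (A _ (chartDInv x₀ _ u)) = _
    rw [hA _ hz, chartD_chartDInv hz, (extChartAt 𝓘(ℝ, E) x₀).right_inv hy]

end Sections

section LieBracket

theorem mlieBracket_modelSpace (X Y : E → E) (y : E) :
    mlieBracket 𝓘(ℝ, E) (X : ∀ z : E, TangentSpace 𝓘(ℝ, E) z) Y y =
      fderiv ℝ Y y (X y) - fderiv ℝ X y (Y y) := by
  refine (congrFun (mlieBracketWithin_univ (I := 𝓘(ℝ, E))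
    (V := (X : ∀ z : E, TangentSpace 𝓘(ℝ, E) z)) (W := Y)).symm y).trans ?_
  exact (congrFun mlieBracketWithin_eq_lieBracketWithin y).trans
    (congrFun (lieBracketWithin_univ (𝕜 := ℝ) (V := X) (W := Y)) y)

theorem chartD_mlieBracket [CompleteSpace E] {X Y : ∀ x : M, TangentSpace 𝓘(ℝ, E) x}
    (hx : x ∈ (extChartAt 𝓘(ℝ, E) x₀).source) (hX : MDiffAt (T% X) x) (hY : MDiffAt (T% Y) x) :
    chartD x₀ x (mlieBracket 𝓘(ℝ, E) X Y x) =
      fderiv ℝ (chartField x₀ Y) (extChartAt 𝓘(ℝ, E) x₀ x) (chartD x₀ x (X x)) -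
      fderiv ℝ (chartField x₀ X) (extChartAt 𝓘(ℝ, E) x₀ x) (chartD x₀ x (Y x)) := by
  have hy := (extChartAt 𝓘(ℝ, E) x₀).map_source hx
  have hxy := (extChartAt 𝓘(ℝ, E) x₀).left_inv hx
  have : IsManifold 𝓘(ℝ, E) (minSmoothness ℝ 2) M := by
    rw [minSmoothness_of_isRCLikeNormedField]
    infer_instance
  have hpull := mpullback_mlieBracket (I := 𝓘(ℝ, E)) (I' := 𝓘(ℝ, E)) (n := ∞)
    (f := (extChartAt 𝓘(ℝ, E) x₀).symm) (V := X) (W := Y) (x₀ := extChartAt 𝓘(ℝ, E) x₀ x)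
    (by rwa [hxy]) (by rwa [hxy])
    ((contMDiffOn_extChartAt_symm (n := ∞) x₀).contMDiffAt
      (extChartAt_target_mem_nhds_of_mem_source hx))
    (by rw [minSmoothness_of_isRCLikeNormedField]; exact WithTop.coe_le_coe.2 (le_top (α := ℕ∞)))
  have hfield (σ : ∀ x : M, TangentSpace 𝓘(ℝ, E) x) :
      mpullback 𝓘(ℝ, E) 𝓘(ℝ, E) (extChartAt 𝓘(ℝ, E) x₀).symm σ
        =ᶠ[𝓝 (extChartAt 𝓘(ℝ, E) x₀ x)] chartField x₀ σ :=
    Filter.mem_of_superset (extChartAt_target_mem_nhds_of_mem_source hx)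
      fun _ ↦ mpullback_extChartAt_symm σ
  rw [← chartField_extChartAt hx, ← mpullback_extChartAt_symm _ hy, hpull,
    Filter.EventuallyEq.mlieBracket_vectorField_eq (hfield X) (hfield Y),
    ← chartField_extChartAt hx X, ← chartField_extChartAt hx Y]
  exact mlieBracket_modelSpace _ _ _

end LieBracket

end Charts

section ChartConnection

open Set VectorField

variable {E : Type*} [NormedAddCommGroup E] [NormedSpace ℝ E]
  {M : Type*} [TopologicalSpace M] [ChartedSpace E M] [IsManifold 𝓘(ℝ, E) ∞ M]

/-- The connection with Christoffel tensor `Γ` in the preferred chart at `x₀`. It only makes sense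
on the domain of that chart. -/
def chartConnection (x₀ : M) (Γ : E → E →L[ℝ] E →L[ℝ] E)
    (σ : ∀ x : M, TangentSpace 𝓘(ℝ, E) x) (x : M) :
    TangentSpace 𝓘(ℝ, E) x →L[ℝ] TangentSpace 𝓘(ℝ, E) x :=
  (chartDInv x₀ x).comp ((fderiv ℝ (chartField x₀ σ) (extChartAt 𝓘(ℝ, E) x₀ x) +
    (Γ (extChartAt 𝓘(ℝ, E) x₀ x)).flip (chartField x₀ σ (extChartAt 𝓘(ℝ, E) x₀ x))).comp
      (chartD x₀ x))

variable {x₀ x : M} {Γ : E → E →L[ℝ] E →L[ℝ] E} {σ : ∀ x : M, TangentSpace 𝓘(ℝ, E) x}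

theorem chartD_chartConnection (hx : x ∈ (extChartAt 𝓘(ℝ, E) x₀).source)
    (u : TangentSpace 𝓘(ℝ, E) x) :
    chartD x₀ x (chartConnection x₀ Γ σ x u) =
      fderiv ℝ (chartField x₀ σ) (extChartAt 𝓘(ℝ, E) x₀ x) (chartD x₀ x u) +
        Γ (extChartAt 𝓘(ℝ, E) x₀ x) (chartD x₀ x u) (chartD x₀ x (σ x)) := by
  rw [chartConnection, ContinuousLinearMap.comp_apply, chartD_chartDInv hx,
    chartField_extChartAt hx]
  rfl

theorem chartConnection_add {σ' : ∀ x : M, TangentSpace 𝓘(ℝ, E) x}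
    (hx : x ∈ (extChartAt 𝓘(ℝ, E) x₀).source) (hσ : MDiffAt (T% σ) x) (hσ' : MDiffAt (T% σ') x) :
    chartConnection x₀ Γ (σ + σ') x = chartConnection x₀ Γ σ x + chartConnection x₀ Γ σ' x := by
  rw [mdifferentiableAt_iff_differentiableAt_chartField hx] at hσ hσ'
  have hfield : chartField x₀ (σ + σ') = chartField x₀ σ + chartField x₀ σ' :=
    funext fun _ ↦ map_add (chartD _ _) _ _
  ext u
  apply chartD_injective hx
  rw [add_apply, map_add, chartD_chartConnection hx, chartD_chartConnection hx,
    chartD_chartConnection hx, hfield, fderiv_add hσ hσ', Pi.add_apply, map_add, map_add, add_apply]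
  abel

theorem chartConnection_smul {g : M → ℝ} (hx : x ∈ (extChartAt 𝓘(ℝ, E) x₀).source)
    (hσ : MDiffAt (T% σ) x) (hg : MDiffAt g x) :
    chartConnection x₀ Γ (g • σ) x =
      g x • chartConnection x₀ Γ σ x + (mvfderiv 𝓘(ℝ, E) g x).smulRight (σ x) := by
  rw [mdifferentiableAt_iff_differentiableAt_chartField hx] at hσ
  rw [mdifferentiableAt_iff_differentiableAt_of_eqOn hx (eqOn_refl _ _)] at hg
  have hfield : chartField x₀ (g • σ) =
      fun y ↦ (g ∘ (extChartAt 𝓘(ℝ, E) x₀).symm) y • chartField x₀ σ y :=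
    funext fun _ ↦ map_smul (chartD _ _) _ _
  have hgx : (g ∘ (extChartAt 𝓘(ℝ, E) x₀).symm) (extChartAt 𝓘(ℝ, E) x₀ x) = g x :=
    congrArg g ((extChartAt 𝓘(ℝ, E) x₀).left_inv hx)
  ext u
  have hgu : mvfderiv 𝓘(ℝ, E) g x u = _ := mfderiv_of_eqOn hx (eqOn_refl _ _) hg u
  apply chartD_injective hx
  rw [add_apply, ContinuousLinearMap.smulRight_apply, hgu, map_add, map_smul, smul_apply, map_smul,
    chartD_chartConnection hx, chartD_chartConnection hx, hfield, fderiv_fun_smul hg hσ,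
    chartField_extChartAt hx, hgx, Pi.smul_apply', map_smul, map_smul, add_apply, smul_apply,
    ContinuousLinearMap.smulRight_apply, smul_add]
  abel

theorem isCovariantDerivativeOn_chartConnection :
    IsCovariantDerivativeOn E (chartConnection x₀ Γ) (extChartAt 𝓘(ℝ, E) x₀).source where
  add hσ hσ' hx := chartConnection_add hx hσ hσ'
  leibniz hσ hg hx := chartConnection_smul hx hσ hg

theorem contMDiffAt_chartConnection
    (hΓ : ContDiffOn ℝ ∞ Γ (extChartAt 𝓘(ℝ, E) x₀).target)
    (hx : x ∈ (extChartAt 𝓘(ℝ, E) x₀).source) (hσ : CMDiffAt ∞ (T% σ) x) :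
    ContMDiffAt 𝓘(ℝ, E) (𝓘(ℝ, E).prod 𝓘(ℝ, E →L[ℝ] E)) ∞
      (fun z ↦ (⟨z, chartConnection x₀ Γ σ z⟩ : TotalSpace (E →L[ℝ] E)
        fun z : M ↦ TangentSpace 𝓘(ℝ, E) z →L[ℝ] TangentSpace 𝓘(ℝ, E) z)) x := by
  rw [contMDiffAt_iff_contDiffAt_chartField hx] at hσ
  refine (contMDiffAt_endomorphism_iff (A := chartConnection x₀ Γ σ)
    (B := fun y ↦ fderiv ℝ (chartField x₀ σ) y + (Γ y).flip (chartField x₀ σ y)) hx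
    fun z hz u ↦ ?_).2 ?_
  · rw [chartD_chartConnection hz, ← chartField_extChartAt hz]
    rfl
  · exact (hσ.fderiv_right (by simp)).add <| ContDiffAt.clm_apply
      ((ContinuousLinearMap.flipₗᵢ ℝ E E E).contDiff.contDiffAt.comp _
        (hΓ.contDiffAt (extChartAt_target_mem_nhds_of_mem_source hx))) hσ

theorem chartConnection_torsion [CompleteSpace E] {X Y : ∀ x : M, TangentSpace 𝓘(ℝ, E) x}
    (hx : x ∈ (extChartAt 𝓘(ℝ, E) x₀).source)
    (hΓ : ∀ u v, Γ (extChartAt 𝓘(ℝ, E) x₀ x) u v = Γ (extChartAt 𝓘(ℝ, E) x₀ x) v u)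
    (hX : MDiffAt (T% X) x) (hY : MDiffAt (T% Y) x) :
    chartConnection x₀ Γ Y x (X x) - chartConnection x₀ Γ X x (Y x) =
      mlieBracket 𝓘(ℝ, E) X Y x := by
  apply chartD_injective hx
  rw [map_sub, chartD_chartConnection hx, chartD_chartConnection hx,
    chartD_mlieBracket hx hX hY, hΓ]
  abel

theorem chartConnection_eq_zero (hx : x ∈ (extChartAt 𝓘(ℝ, E) x₀).source)
    (h : ∀ u, fderiv ℝ (chartField x₀ σ) (extChartAt 𝓘(ℝ, E) x₀ x) u +
      Γ (extChartAt 𝓘(ℝ, E) x₀ x) u (chartField x₀ σ (extChartAt 𝓘(ℝ, E) x₀ x)) = 0) :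
    chartConnection x₀ Γ σ x = 0 := by
  ext u
  apply chartD_injective hx
  rw [chartD_chartConnection hx, ← chartField_extChartAt hx, h, zero_apply, map_zero]

theorem mfderiv_bilin_chartConnection {Y Z : ∀ x : M, TangentSpace 𝓘(ℝ, E) x}
    {f : ∀ x : M, TangentSpace 𝓘(ℝ, E) x → TangentSpace 𝓘(ℝ, E) x → ℝ}
    {b : E → E →L[ℝ] E →L[ℝ] ℝ} (hx : x ∈ (extChartAt 𝓘(ℝ, E) x₀).source)
    (hf : ∀ z ∈ (extChartAt 𝓘(ℝ, E) x₀).source, ∀ v w,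
      f z v w = b (extChartAt 𝓘(ℝ, E) x₀ z) (chartD x₀ z v) (chartD x₀ z w))
    (hb : DifferentiableAt ℝ b (extChartAt 𝓘(ℝ, E) x₀ x))
    (hΓ : ∀ u v w, fderiv ℝ b (extChartAt 𝓘(ℝ, E) x₀ x) u v w =
      b (extChartAt 𝓘(ℝ, E) x₀ x) (Γ (extChartAt 𝓘(ℝ, E) x₀ x) u v) w +
        b (extChartAt 𝓘(ℝ, E) x₀ x) v (Γ (extChartAt 𝓘(ℝ, E) x₀ x) u w))
    (hY : MDiffAt (T% Y) x) (hZ : MDiffAt (T% Z) x) (u : TangentSpace 𝓘(ℝ, E) x) :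
    mfderiv% (fun z ↦ f z (Y z) (Z z)) x u =
      f x (chartConnection x₀ Γ Y x u) (Z x) + f x (Y x) (chartConnection x₀ Γ Z x u) := by
  rw [mdifferentiableAt_iff_differentiableAt_chartField hx] at hY hZ
  have hderiv := (hb.hasFDerivAt.clm_apply hY.hasFDerivAt).clm_apply hZ.hasFDerivAt
  have hcoord : EqOn ((fun z ↦ f z (Y z) (Z z)) ∘ (extChartAt 𝓘(ℝ, E) x₀).symm)
      (fun y ↦ b y (chartField x₀ Y y) (chartField x₀ Z y)) (extChartAt 𝓘(ℝ, E) x₀).target :=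
    fun y hy ↦ by
      rw [Function.comp_apply, hf _ ((extChartAt 𝓘(ℝ, E) x₀).map_target hy),
        (extChartAt 𝓘(ℝ, E) x₀).right_inv hy]
      rfl
  have hleibniz : fderiv ℝ (fun y ↦ b y (chartField x₀ Y y) (chartField x₀ Z y))
      (extChartAt 𝓘(ℝ, E) x₀ x) (chartD x₀ x u) =
      f x (chartConnection x₀ Γ Y x u) (Z x) + f x (Y x) (chartConnection x₀ Γ Z x u) := by
    rw [hderiv.fderiv, hf x hx, hf x hx, chartD_chartConnection hx, chartD_chartConnection hx]
    simp only [chartField_extChartAt hx, add_apply, ContinuousLinearMap.comp_apply,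
      ContinuousLinearMap.flip_apply, hΓ, map_add]
    ring
  exact (mfderiv_of_eqOn hx hcoord hderiv.differentiableAt u).trans hleibniz

end ChartConnection

section Gluing

open Set VectorField

variable {E : Type*} [NormedAddCommGroup E] [NormedSpace ℝ E]
  {M : Type*} [TopologicalSpace M] [ChartedSpace E M]
  {V : M → Type*} [∀ x, AddCommGroup (V x)] [∀ x, Module ℝ (V x)] [∀ x, TopologicalSpace (V x)]
  [∀ x, IsTopologicalAddGroup (V x)] [∀ x, ContinuousSMul ℝ (V x)] {ι : Type*}

/-- The weighted sum of a family of operators on sections. It is a connection if the `i`-th operator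
is a connection on a set containing the support of `ρ i`. -/
def gluedConnection (ρ : SmoothPartitionOfUnity ι 𝓘(ℝ, E) M univ)
    (cov : ι → (∀ x, V x) → ∀ x, TangentSpace 𝓘(ℝ, E) x →L[ℝ] V x) (σ : ∀ x, V x) (x : M) :
    TangentSpace 𝓘(ℝ, E) x →L[ℝ] V x :=
  ∑ᶠ i, ρ i x • cov i σ x

variable {ρ : SmoothPartitionOfUnity ι 𝓘(ℝ, E) M univ}
  {cov : ι → (∀ x, V x) → ∀ x, TangentSpace 𝓘(ℝ, E) x →L[ℝ] V x} {U : ι → Set M}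

theorem apply_gluedConnection_eq {W : Type*} [AddCommGroup W] [Module ℝ W] {x : M}
    {T : ((∀ x, V x) → TangentSpace 𝓘(ℝ, E) x →L[ℝ] V x) → W} (hT : IsLinearMap ℝ T)
    (hρ : ρ.IsSubordinate U) {c : W} (h : ∀ i, x ∈ U i → T (cov i · x) = c) :
    T (gluedConnection ρ cov · x) = c := by
  have hsum : (gluedConnection ρ cov · x) = ∑ i ∈ ρ.finsupport x, ρ i x • (cov i · x) := by
    funext σ
    rw [Finset.sum_apply]
    exact (ρ.sum_finsupport_smul_eq_finsum x fun i _ ↦ cov i σ x).symm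
  calc T (gluedConnection ρ cov · x)
      = ∑ i ∈ ρ.finsupport x, ρ i x • T (cov i · x) := by
        rw [hsum, ← hT.mk'_apply, map_sum]
        simp only [hT.mk'_apply, hT.map_smul]
    _ = ∑ i ∈ ρ.finsupport x, ρ i x • c :=
        Finset.sum_congr rfl fun i hi ↦ by
          rw [h i (hρ i (subset_tsupport _ ((ρ.mem_finsupport x).1 hi)))]
    _ = c := by rw [← Finset.sum_smul, ρ.sum_finsupport x (mem_univ x), one_smul]

variable {F : Type*} [NormedAddCommGroup F] [NormedSpace ℝ F] [TopologicalSpace (TotalSpace F V)]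
  [FiberBundle F V]

theorem isCovariantDerivativeOn_gluedConnection (hρ : ρ.IsSubordinate U)
    (h : ∀ i, IsCovariantDerivativeOn F (cov i) (U i)) :
    IsCovariantDerivativeOn F (gluedConnection ρ cov) univ where
  add {σ σ' x} hσ hσ' _ := by
    refine sub_eq_zero.1 <| apply_gluedConnection_eq
      (T := fun D ↦ D (σ + σ') - (D σ + D σ')) ⟨?_, ?_⟩ hρ fun i hi ↦
        sub_eq_zero.2 ((h i).add hσ hσ' hi)
    · exact fun _ _ ↦ by simp only [Pi.add_apply]; abel
    · exact fun _ _ ↦ by simp only [Pi.smul_apply, smul_sub, smul_add]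
  leibniz {σ g x} hσ hg _ := by
    refine sub_eq_iff_eq_add'.1 <| apply_gluedConnection_eq
      (T := fun D ↦ D (g • σ) - g x • D σ) ⟨?_, ?_⟩ hρ fun i hi ↦
        sub_eq_iff_eq_add'.2 ((h i).leibniz hσ hg hi)
    · exact fun _ _ ↦ by simp only [Pi.add_apply, smul_add]; abel
    · exact fun c _ ↦ by simp only [Pi.smul_apply, smul_sub, smul_comm c]

/-- The connection glued from connections on the members of an open cover. -/
def gluedCovariantDerivative (hρ : ρ.IsSubordinate U)
    (h : ∀ i, IsCovariantDerivativeOn F (cov i) (U i)) : CovariantDerivative 𝓘(ℝ, E) F V :=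
  ⟨gluedConnection ρ cov, isCovariantDerivativeOn_gluedConnection hρ h⟩

theorem contMDiff_gluedConnection [IsManifold 𝓘(ℝ, E) ∞ M] [VectorBundle ℝ F V]
    [ContMDiffVectorBundle ∞ F V 𝓘(ℝ, E)] (hρ : ρ.IsSubordinate U)
    (hU : ∀ i, IsOpen (U i)) {σ : ∀ x, V x}
    (hcov : ∀ i, ContMDiffOn 𝓘(ℝ, E) (𝓘(ℝ, E).prod 𝓘(ℝ, E →L[ℝ] F)) ∞
      (fun x ↦ (⟨x, cov i σ x⟩ : TotalSpace (E →L[ℝ] F)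
        fun x : M ↦ TangentSpace 𝓘(ℝ, E) x →L[ℝ] V x)) (U i)) :
    ContMDiff 𝓘(ℝ, E) (𝓘(ℝ, E).prod 𝓘(ℝ, E →L[ℝ] F)) ∞
      (fun x ↦ (⟨x, gluedConnection ρ cov σ x⟩ : TotalSpace (E →L[ℝ] F)
        fun x : M ↦ TangentSpace 𝓘(ℝ, E) x →L[ℝ] V x)) := by
  refine ContMDiff.finsum_section_of_locallyFinite (t := fun i x ↦ ρ i x • cov i σ x) ?_ fun i ↦
    ContMDiffOn.smul_section_of_tsupport (s := cov i σ) (ρ i).contMDiff.contMDiffOn (hU i) (hρ i)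
      (hcov i)
  exact ρ.locallyFinite.subset fun i x hx hρx ↦ hx (by simp only [hρx, zero_smul])

theorem torsion_gluedCovariantDerivative [IsManifold 𝓘(ℝ, E) ∞ M] [FiniteDimensional ℝ E]
    [CompleteSpace E]
    {cov : ι → (∀ x : M, TangentSpace 𝓘(ℝ, E) x) →
      ∀ x, TangentSpace 𝓘(ℝ, E) x →L[ℝ] TangentSpace 𝓘(ℝ, E) x} (hρ : ρ.IsSubordinate U)
    (h : ∀ i, IsCovariantDerivativeOn E (cov i) (U i))
    (htorsion : ∀ i {X Y : ∀ x : M, TangentSpace 𝓘(ℝ, E) x}, ∀ x ∈ U i, MDiffAt (T% X) x →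
      MDiffAt (T% Y) x → cov i Y x (X x) - cov i X x (Y x) = mlieBracket 𝓘(ℝ, E) X Y x) :
    (gluedCovariantDerivative hρ h).torsion = 0 := by
  refine (CovariantDerivative.torsion_eq_zero_iff _).2 fun {X Y x} hX hY ↦ apply_gluedConnection_eq
    (T := fun D ↦ D Y (X x) - D X (Y x)) ⟨?_, ?_⟩ hρ fun i hi ↦ htorsion i x hi hX hY
  · exact fun _ _ ↦ by simp only [Pi.add_apply, add_apply]; abel
  · exact fun _ _ ↦ by simp only [Pi.smul_apply, smul_apply, smul_sub]

end Gluing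

section Transition

open Set Topology

variable {E : Type*} [NormedAddCommGroup E] [NormedSpace ℝ E]
  {M : Type*} [TopologicalSpace M] [ChartedSpace E M] [IsManifold 𝓘(ℝ, E) ∞ M] {x₀ x₁ x : M}

theorem contDiffAt_transition (h₀ : x ∈ (extChartAt 𝓘(ℝ, E) x₀).source)
    (h₁ : x ∈ (extChartAt 𝓘(ℝ, E) x₁).source) :
    ContDiffAt ℝ ∞ (extChartAt 𝓘(ℝ, E) x₁ ∘ (extChartAt 𝓘(ℝ, E) x₀).symm)
      (extChartAt 𝓘(ℝ, E) x₀ x) :=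
  (contMDiffAt_iff_contDiffAt_of_eqOn h₀ (eqOn_refl _ _)).1
    (contMDiffAt_extChartAt' (mem_chartAt_source h₁))

theorem fderiv_transition (h₀ : x ∈ (extChartAt 𝓘(ℝ, E) x₀).source)
    (h₁ : x ∈ (extChartAt 𝓘(ℝ, E) x₁).source) (v : E) :
    fderiv ℝ (extChartAt 𝓘(ℝ, E) x₁ ∘ (extChartAt 𝓘(ℝ, E) x₀).symm) (extChartAt 𝓘(ℝ, E) x₀ x) v =
      chartD x₁ x (chartDInv x₀ x v) := by
  have hderiv := mfderiv_of_eqOn h₀ (eqOn_refl _ _)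
    ((contDiffAt_transition h₀ h₁).differentiableAt (by simp)) (chartDInv x₀ x v)
  rw [chartD_chartDInv h₀, ← chartD_eq_mfderiv h₁] at hderiv
  exact hderiv.symm

end Transition

section ModelForms

variable {F : Type*} [NormedAddCommGroup F] [NormedSpace ℝ F]

variable (F) in
/-- The linear form of a 1-form, as a continuous linear map. -/
def formLin : F [⋀^Fin 1]→L[ℝ] ℝ →L[ℝ] F →L[ℝ] ℝ :=
  (ContinuousAlternatingMap.ofSubsingletonLIE (𝕜 := ℝ) (E := F) (F := ℝ)
    (0 : Fin 1)).symm.toContinuousLinearEquiv.toContinuousLinearMap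

theorem formLin_apply (a : F [⋀^Fin 1]→L[ℝ] ℝ) (v : F) : formLin F a v = a ![v] :=
  congrArg a (funext fun i ↦ (Matrix.cons_val_fin_one v ![] i).symm)

variable (F) in
/-- The bilinear form of a 2-form, as a continuous linear map. -/
def formBilin : F [⋀^Fin 2]→L[ℝ] ℝ →L[ℝ] F →L[ℝ] F →L[ℝ] ℝ :=
  (ContinuousLinearMap.compL ℝ F (F [⋀^Fin 1]→L[ℝ] ℝ) (F →L[ℝ] ℝ) (formLin F)).comp
    ContinuousAlternatingMap.curryLeftLI.toContinuousLinearMap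

theorem formBilin_apply (β : F [⋀^Fin 2]→L[ℝ] ℝ) (v w : F) : formBilin F β v w = β ![v, w] :=
  formLin_apply (β.curryLeft v) w

theorem contDiffOn_formLin {a : F → F [⋀^Fin 1]→L[ℝ] ℝ} {s : Set F} {m : WithTop ℕ∞}
    (ha : ContDiffOn ℝ m a s) : ContDiffOn ℝ m (fun y ↦ formLin F (a y)) s :=
  (formLin F).contDiff.comp_contDiffOn ha

theorem contDiffOn_formBilin {β : F → F [⋀^Fin 2]→L[ℝ] ℝ} {s : Set F} {m : WithTop ℕ∞}
    (hβ : ContDiffOn ℝ m β s) : ContDiffOn ℝ m (fun y ↦ formBilin F (β y)) s :=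
  (formBilin F).contDiff.comp_contDiffOn hβ

theorem cyclic_sum_of_alternatizeUncurryFin_eq_zero {D : F →L[ℝ] F [⋀^Fin 2]→L[ℝ] ℝ}
    (hD : ContinuousAlternatingMap.alternatizeUncurryFin D = 0) (u v w : F) :
    D u ![v, w] + D v ![w, u] + D w ![u, v] = 0 := by
  have remove_zero : (0 : Fin 3).removeNth ![u, v, w] = ![v, w] := by
    ext i; fin_cases i <;> rfl
  have remove_one : (1 : Fin 3).removeNth ![u, v, w] = ![u, w] := by
    ext i; fin_cases i <;> rfl
  have remove_two : (2 : Fin 3).removeNth ![u, v, w] = ![u, v] := by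
    ext i; fin_cases i <;> rfl
  have hswap : D v ![w, u] = -D v ![u, w] := apply_pair_swap (D v).toAlternatingMap w u
  have hsum : D u ![v, w] - D v ![u, w] + D w ![u, v] = 0 := by
    simpa [ContinuousAlternatingMap.alternatizeUncurryFin_apply, Fin.sum_univ_three, remove_zero,
      remove_one, remove_two, ← sub_eq_add_neg] using congrArg (· ![u, v, w]) hD
  linarith

theorem cyclic_sum_fderiv_formBilin {β : F → F [⋀^Fin 2]→L[ℝ] ℝ} {y : F}
    (hβ : DifferentiableAt ℝ β y) (hd : extDeriv β y = 0) (u v w : F) :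
    fderiv ℝ (fun z ↦ formBilin F (β z)) y u v w + fderiv ℝ (fun z ↦ formBilin F (β z)) y v w u +
      fderiv ℝ (fun z ↦ formBilin F (β z)) y w u v = 0 := by
  have hderiv : fderiv ℝ (fun z ↦ formBilin F (β z)) y = (formBilin F).comp (fderiv ℝ β y) :=
    ((formBilin F).hasFDerivAt.comp y hβ.hasFDerivAt).fderiv
  simp only [hderiv, ContinuousLinearMap.comp_apply, formBilin_apply]
  exact cyclic_sum_of_alternatizeUncurryFin_eq_zero hd u v w

end ModelForms

section ManifoldForms

open Set Topology

variable {n : ℕ} {M : Type*} [TopologicalSpace M]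
  [ChartedSpace (EuclideanSpace ℝ (Fin n)) M] [IsManifold (𝓡 n) ∞ M] {k : ℕ}
  (β : DiffForm (n := n) M k) {x₀ : M}

theorem inChart_apply {y : EuclideanSpace ℝ (Fin n)} (hy : y ∈ (extChartAt (𝓡 n) x₀).target)
    (m : Fin k → EuclideanSpace ℝ (Fin n)) :
    β.inChart x₀ y m = β ((extChartAt (𝓡 n) x₀).symm y)
      fun i ↦ chartDInv x₀ ((extChartAt (𝓡 n) x₀).symm y) (m i) :=
  congrArg (β ((extChartAt (𝓡 n) x₀).symm y))
    (funext fun i ↦ mfderiv_extChartAt_symm_apply hy (m i))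

theorem apply_eq_inChart {x : M} (hx : x ∈ (extChartAt (𝓡 n) x₀).source)
    (m : Fin k → TangentSpace (𝓡 n) x) :
    β x m = β.inChart x₀ (extChartAt (𝓡 n) x₀ x) fun i ↦ chartD x₀ x (m i) := by
  rw [inChart_apply β ((extChartAt (𝓡 n) x₀).map_source hx), (extChartAt (𝓡 n) x₀).left_inv hx]
  simp only [chartDInv_chartD hx]

theorem apply_single_eq_inChart (α : DiffForm (n := n) M 1) {x : M}
    (hx : x ∈ (extChartAt (𝓡 n) x₀).source) (v : TangentSpace (𝓡 n) x) :
    α x ![v] = formLin _ (α.inChart x₀ (extChartAt (𝓡 n) x₀ x)) (chartD x₀ x v) := by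
  rw [apply_eq_inChart α hx, formLin_apply]
  exact congrArg _ (funext fun i ↦ by fin_cases i; rfl)

theorem apply_pair_eq_inChart (Ω : DiffForm (n := n) M 2) {x : M}
    (hx : x ∈ (extChartAt (𝓡 n) x₀).source) (v w : TangentSpace (𝓡 n) x) :
    Ω x ![v, w] =
      formBilin _ (Ω.inChart x₀ (extChartAt (𝓡 n) x₀ x)) (chartD x₀ x v) (chartD x₀ x w) := by
  rw [apply_eq_inChart Ω hx, formBilin_apply]
  exact congrArg _ (funext fun i ↦ by fin_cases i <;> rfl)

theorem extDeriv_inChart_self_eq_zero {x : M} (hd : β.extD x = 0) :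
    extDeriv (β.inChart x) (extChartAt (𝓡 n) x x) = 0 := by
  ext m
  have hm : (fun i ↦ mfderiv (𝓡 n) 𝓘(ℝ, EuclideanSpace ℝ (Fin n)) (extChartAt (𝓡 n) x) x
      (chartDInv x x (m i))) = m := funext fun i ↦ by
    rw [← chartD_eq_mfderiv (mem_extChartAt_source x)]
    exact chartD_chartDInv (mem_extChartAt_source x) (m i)
  have hzero := congrArg (fun l ↦ l fun i ↦ chartDInv x x (m i)) hd
  refine Eq.trans ?_ hzero
  exact congrArg (extDeriv (β.inChart x) (extChartAt (𝓡 n) x x)) hm.symm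

theorem inChart_eq_pullback_transition {x x₁ : M} (h₀ : x ∈ (extChartAt (𝓡 n) x₀).source)
    (h₁ : x ∈ (extChartAt (𝓡 n) x₁).source) :
    β.inChart x₀ (extChartAt (𝓡 n) x₀ x) =
      (β.inChart x₁ (extChartAt (𝓡 n) x₁ x)).compContinuousLinearMap
        (fderiv ℝ (extChartAt (𝓡 n) x₁ ∘ (extChartAt (𝓡 n) x₀).symm) (extChartAt (𝓡 n) x₀ x)) := by
  ext m
  rw [inChart_apply β ((extChartAt (𝓡 n) x₀).map_source h₀), (extChartAt (𝓡 n) x₀).left_inv h₀,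
    apply_eq_inChart β h₁]
  simp only [ContinuousAlternatingMap.compContinuousLinearMap_apply, Function.comp_def,
    ← fderiv_transition h₀ h₁]

variable {β}

theorem extDeriv_inChart_eq_zero (hβ : DiffForm.IsSmooth β) (hd : ∀ x, DiffForm.extD β x = 0)
    {y : EuclideanSpace ℝ (Fin n)} (hy : y ∈ (extChartAt (𝓡 n) x₀).target) :
    extDeriv (β.inChart x₀) y = 0 := by
  let x := (extChartAt (𝓡 n) x₀).symm y
  have hx : x ∈ (extChartAt (𝓡 n) x₀).source := (extChartAt (𝓡 n) x₀).map_target hy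
  have hxy : extChartAt (𝓡 n) x₀ x = y := (extChartAt (𝓡 n) x₀).right_inv hy
  have hxx : x ∈ (extChartAt (𝓡 n) x).source := mem_extChartAt_source x
  let ψ := extChartAt (𝓡 n) x ∘ (extChartAt (𝓡 n) x₀).symm
  have hpullback : β.inChart x₀ =ᶠ[𝓝 y] fun z ↦
      (β.inChart x (ψ z)).compContinuousLinearMap (fderiv ℝ ψ z) := by
    filter_upwards [(isOpen_extChartAt_target x₀).mem_nhds hy,
      (continuousAt_extChartAt_symm'' hy).eventually
        ((isOpen_extChartAt_source x).mem_nhds hxx)] with z hz hzx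
    have h := inChart_eq_pullback_transition β ((extChartAt (𝓡 n) x₀).map_target hz) hzx
    rwa [(extChartAt (𝓡 n) x₀).right_inv hz] at h
  have hψ : ContDiffAt ℝ ∞ ψ y := hxy ▸ contDiffAt_transition hx hxx
  have hβx : DifferentiableAt ℝ (β.inChart x) (ψ y) :=
    ((hβ x).contDiffAt (extChartAt_target_mem_nhds_of_mem_source hxx)).differentiableAt (by simp)
  have hsmoothness : minSmoothness ℝ 2 ≤ ∞ := by
    rw [minSmoothness_of_isRCLikeNormedField]
    exact WithTop.coe_le_coe.2 le_top
  have hzero : extDeriv (β.inChart x) (ψ y) = 0 := extDeriv_inChart_self_eq_zero β (hd x)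
  rw [hpullback.extDeriv_eq, extDeriv_pullback hβx hψ hsmoothness, hzero]
  rfl

end ManifoldForms

section ReebField

open Set

variable {d : ℕ} {M : Type*} [TopologicalSpace M]
  [ChartedSpace (EuclideanSpace ℝ (Fin (2 * d + 1))) M]
  {Ω : DiffForm (n := 2 * d + 1) M 2} {α : DiffForm (n := 2 * d + 1) M 1}
  {E : ∀ x : M, TangentSpace (𝓡 (2 * d + 1)) x}

/-- A framed Hamiltonian structure `(Ω, α)`: a smooth closed 2-form and a smooth 1-form such that
`α ∧ Ω ^ d` vanishes nowhere. -/
structure IsFramedHamiltonian (Ω : DiffForm (n := 2 * d + 1) M 2)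
    (α : DiffForm (n := 2 * d + 1) M 1) : Prop where
  smooth_form : DiffForm.IsSmooth Ω
  closed : ∀ x, DiffForm.extD Ω x = 0
  smooth : DiffForm.IsSmooth α
  volume_ne_zero : ∀ x, wedge (α x).toAlternatingMap (wedgePow (Ω x).toAlternatingMap d) ≠ 0

theorem IsStableHamiltonian.isFramedHamiltonian (h : IsStableHamiltonian Ω α) :
    IsFramedHamiltonian Ω α :=
  ⟨h.isHamiltonian.smooth, h.isHamiltonian.closed, h.smooth, h.volume_ne_zero⟩

instance {n : ℕ} {M : Type*} [TopologicalSpace M] [ChartedSpace (EuclideanSpace ℝ (Fin n)) M]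
    (x : M) : FiniteDimensional ℝ (TangentSpace (𝓡 n) x) :=
  inferInstanceAs (FiniteDimensional ℝ (EuclideanSpace ℝ (Fin n)))

theorem finrank_tangentSpace {n : ℕ} {M : Type*} [TopologicalSpace M]
    [ChartedSpace (EuclideanSpace ℝ (Fin n)) M] (x : M) :
    Module.finrank ℝ (TangentSpace (𝓡 n) x) = n :=
  finrank_euclideanSpace_fin

theorem IsFramedHamiltonian.eq_zero (h : IsFramedHamiltonian Ω α) {x : M}
    {v : TangentSpace (𝓡 (2 * d + 1)) x} (hΩ : ∀ w, Ω x ![v, w] = 0) (hα : α x ![v] = 0) :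
    v = 0 :=
  eq_zero_of_wedge_wedgePow_ne_zero (finrank_tangentSpace x) (h.volume_ne_zero x) hΩ hα

theorem IsFramedHamiltonian.exists_isReebField (h : IsFramedHamiltonian Ω α) :
    ∃ E : ∀ x : M, TangentSpace (𝓡 (2 * d + 1)) x, IsReebField Ω α E := by
  choose E hE using fun x ↦ exists_reeb_vector (finrank_tangentSpace x) (h.volume_ne_zero x)
  exact ⟨E, hE⟩

theorem IsReebField.eq (h : IsFramedHamiltonian Ω α) (hE : IsReebField Ω α E)
    {E' : ∀ x : M, TangentSpace (𝓡 (2 * d + 1)) x} (hE' : IsReebField Ω α E') (x : M) :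
    E' x = E x :=
  reeb_vector_unique (finrank_tangentSpace x) (h.volume_ne_zero x) (hE' x) (hE x)

variable [IsManifold (𝓡 (2 * d + 1)) ∞ M]

theorem IsFramedHamiltonian.isInvertible_pairing_inChart (h : IsFramedHamiltonian Ω α) (x₀ : M)
    {y : EuclideanSpace ℝ (Fin (2 * d + 1))}
    (hy : y ∈ (extChartAt (𝓡 (2 * d + 1)) x₀).target) :
    (pairing (formBilin _ (Ω.inChart x₀ y)) (formLin _ (α.inChart x₀ y))).IsInvertible := by
  set x := (extChartAt (𝓡 (2 * d + 1)) x₀).symm y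
  have hx := (extChartAt (𝓡 (2 * d + 1)) x₀).map_target hy
  have hxy := (extChartAt (𝓡 (2 * d + 1)) x₀).right_inv hy
  refine isInvertible_pairing (fun u v ↦ ?_) fun v hΩv hαv ↦ ?_
  · rw [formBilin_apply, formBilin_apply]
    exact apply_pair_swap (Ω.inChart x₀ y).toAlternatingMap u v
  · have hzero : chartDInv x₀ x v = 0 := h.eq_zero
      (fun w ↦ by rw [apply_pair_eq_inChart Ω hx, hxy, chartD_chartDInv hx, hΩv, zero_apply])
      (by rw [apply_single_eq_inChart α hx, hxy, chartD_chartDInv hx, hαv])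
    rw [← chartD_chartDInv hx v, hzero, map_zero]

theorem IsReebField.formBilin_inChart (hE : IsReebField Ω α E) (x₀ : M)
    {y : EuclideanSpace ℝ (Fin (2 * d + 1))}
    (hy : y ∈ (extChartAt (𝓡 (2 * d + 1)) x₀).target) :
    formBilin _ (Ω.inChart x₀ y) (chartField x₀ E y) = 0 := by
  have hx := (extChartAt (𝓡 (2 * d + 1)) x₀).map_target hy
  have happly := apply_pair_eq_inChart Ω hx (E _)
  rw [(extChartAt (𝓡 (2 * d + 1)) x₀).right_inv hy] at happly
  ext w
  rw [← chartD_chartDInv hx w]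
  exact (happly _).symm.trans ((hE _).1 _)

theorem IsReebField.formLin_inChart (hE : IsReebField Ω α E) (x₀ : M)
    {y : EuclideanSpace ℝ (Fin (2 * d + 1))}
    (hy : y ∈ (extChartAt (𝓡 (2 * d + 1)) x₀).target) :
    formLin _ (α.inChart x₀ y) (chartField x₀ E y) = 1 := by
  have happly := apply_single_eq_inChart α ((extChartAt (𝓡 (2 * d + 1)) x₀).map_target hy) (E _)
  rw [(extChartAt (𝓡 (2 * d + 1)) x₀).right_inv hy] at happly
  exact happly.symm.trans (hE _).2

theorem IsReebField.contDiffOn_chartField (h : IsFramedHamiltonian Ω α)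
    (hE : IsReebField Ω α E) (x₀ : M) :
    ContDiffOn ℝ ∞ (chartField x₀ E) (extChartAt (𝓡 (2 * d + 1)) x₀).target :=
  contDiffOn_of_pairing (contDiffOn_formBilin (h.smooth_form x₀))
    (contDiffOn_formLin (h.smooth x₀))
    (fun _ ↦ h.isInvertible_pairing_inChart x₀) (fun _ ↦ hE.formBilin_inChart x₀)
    fun _ ↦ hE.formLin_inChart x₀

theorem IsReebField.contMDiff (h : IsFramedHamiltonian Ω α) (hE : IsReebField Ω α E) :
    ContMDiff (𝓡 (2 * d + 1)) ((𝓡 (2 * d + 1)).prod (𝓡 (2 * d + 1))) ∞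
      (fun x ↦ (⟨x, E x⟩ : TangentBundle (𝓡 (2 * d + 1)) M)) := fun x ↦
  have hx := mem_extChartAt_source (I := 𝓡 (2 * d + 1)) x
  (contMDiffAt_iff_contDiffAt_chartField hx).2 <|
    (hE.contDiffOn_chartField h x).contDiffAt (extChartAt_target_mem_nhds_of_mem_source hx)

end ReebField

section Existence

open Set

variable {d : ℕ} {M : Type*} [TopologicalSpace M]
  [ChartedSpace (EuclideanSpace ℝ (Fin (2 * d + 1))) M] [IsManifold (𝓡 (2 * d + 1)) ∞ M]
  {Ω : DiffForm (n := 2 * d + 1) M 2} {α : DiffForm (n := 2 * d + 1) M 1}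
  {E : ∀ x : M, TangentSpace (𝓡 (2 * d + 1)) x}

theorem IsFramedHamiltonian.exists_isShsChristoffel (h : IsFramedHamiltonian Ω α)
    (hE : IsReebField Ω α E) (x₀ : M) :
    ∃ Γ, ContDiffOn ℝ ∞ Γ (extChartAt (𝓡 (2 * d + 1)) x₀).target ∧
      ∀ y ∈ (extChartAt (𝓡 (2 * d + 1)) x₀).target,
        IsShsChristoffel (formBilin _ (Ω.inChart x₀ y))
          (fderiv ℝ (fun z ↦ formBilin _ (Ω.inChart x₀ z)) y)
          (chartField x₀ E y) (fderiv ℝ (chartField x₀ E) y) (Γ y) := by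
  have htarget := isOpen_extChartAt_target (I := 𝓡 (2 * d + 1)) x₀
  refine exists_contDiffOn_isShsChristoffel htarget
    (contDiffOn_formBilin (h.smooth_form x₀)) (contDiffOn_formLin (h.smooth x₀))
    (hE.contDiffOn_chartField h x₀)
    (fun _ ↦ h.isInvertible_pairing_inChart x₀) (fun y u v ↦ ?_) (fun y hy ↦ ?_)
    (fun _ ↦ hE.formBilin_inChart x₀) fun _ ↦ hE.formLin_inChart x₀
  · rw [formBilin_apply, formBilin_apply]
    exact apply_pair_swap (Ω.inChart x₀ y).toAlternatingMap u v
  · exact cyclic_sum_fderiv_formBilin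
      (((h.smooth_form x₀).contDiffAt (htarget.mem_nhds hy)).differentiableAt (by simp))
      (extDeriv_inChart_eq_zero h.smooth_form h.closed hy)

theorem isShsConnection_gluedCovariantDerivative {n : ℕ} {M : Type*} [TopologicalSpace M]
    [ChartedSpace (EuclideanSpace ℝ (Fin n)) M] [IsManifold (𝓡 n) ∞ M]
    {Ω : DiffForm (n := n) M 2} {E : ∀ x : M, TangentSpace (𝓡 n) x}
    {ρ : SmoothPartitionOfUnity M (𝓡 n) M univ}
    {Γ : M → EuclideanSpace ℝ (Fin n) → EuclideanSpace ℝ (Fin n) →L[ℝ]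
      EuclideanSpace ℝ (Fin n) →L[ℝ] EuclideanSpace ℝ (Fin n)}
    (hρ : ρ.IsSubordinate fun i ↦ (extChartAt (𝓡 n) i).source) (hΩ : DiffForm.IsSmooth Ω)
    (hΓsmooth : ∀ i, ContDiffOn ℝ ∞ (Γ i) (extChartAt (𝓡 n) i).target)
    (hΓ : ∀ i, ∀ y ∈ (extChartAt (𝓡 n) i).target,
      IsShsChristoffel (formBilin _ (Ω.inChart i y))
        (fderiv ℝ (fun z ↦ formBilin _ (Ω.inChart i z)) y)
        (chartField i E y) (fderiv ℝ (chartField i E) y) (Γ i y)) :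
    IsShsConnection Ω E (gluedCovariantDerivative hρ fun i ↦
      isCovariantDerivativeOn_chartConnection (x₀ := i) (Γ := Γ i)) where
  smooth := ⟨⟨fun hσ ↦ by
    rw [contMDiffOn_univ] at hσ ⊢
    exact contMDiff_gluedConnection hρ isOpen_extChartAt_source fun i x hx ↦
      (contMDiffAt_chartConnection (hΓsmooth i) hx (hσ x)).contMDiffWithinAt⟩⟩
  torsion_eq_zero := torsion_gluedCovariantDerivative hρ _ fun i _ _ x hx hX hY ↦
    chartConnection_torsion hx (hΓ i _ ((extChartAt (𝓡 n) i).map_source hx)).comm hX hY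
  parallel_field x := apply_gluedConnection_eq (T := fun D ↦ D E) ⟨fun _ _ ↦ rfl, fun _ _ ↦ rfl⟩
    hρ fun i hx ↦ chartConnection_eq_zero hx
      (hΓ i _ ((extChartAt (𝓡 n) i).map_source hx)).parallel_field
  parallel_form Y Z x u := by
    have hlinear : IsLinearMap ℝ fun D : (∀ x : M, TangentSpace (𝓡 n) x) →
        TangentSpace (𝓡 n) x →L[ℝ] TangentSpace (𝓡 n) x ↦
        toBilin (Ω x).toAlternatingMap (D Y u) (Z x) +
          toBilin (Ω x).toAlternatingMap (Y x) (D Z u) :=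
      ⟨fun _ _ ↦ by simp only [Pi.add_apply, add_apply, map_add, LinearMap.add_apply]; abel,
        fun _ _ ↦ by simp only [Pi.smul_apply, smul_apply, map_smul, LinearMap.smul_apply,
          smul_add]⟩
    refine (apply_gluedConnection_eq hlinear hρ fun i hx ↦ ?_).symm
    exact (mfderiv_bilin_chartConnection (f := fun z v w ↦ Ω z ![v, w])
      (b := fun y ↦ formBilin _ (Ω.inChart i y)) hx (fun z hz ↦ apply_pair_eq_inChart Ω hz)
      (((contDiffOn_formBilin (hΩ i)).contDiffAt
        (extChartAt_target_mem_nhds_of_mem_source hx)).differentiableAt (by simp))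
      (hΓ i _ ((extChartAt (𝓡 n) i).map_source hx)).parallel_form
      ((Y.contMDiff x).mdifferentiableAt (by simp))
      ((Z.contMDiff x).mdifferentiableAt (by simp)) u).symm

theorem IsFramedHamiltonian.exists_isShsConnection [T2Space M] [SecondCountableTopology M]
    (h : IsFramedHamiltonian Ω α) (hE : IsReebField Ω α E) :
    ∃ nabla : LinearConnection (n := 2 * d + 1) M, IsShsConnection Ω E nabla := by
  have : LocallyCompactSpace M := Manifold.locallyCompact_of_finiteDimensional (𝓡 (2 * d + 1))
  have : SigmaCompactSpace M := sigmaCompactSpace_of_locallyCompact_secondCountable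
  obtain ⟨ρ, hρ⟩ := SmoothPartitionOfUnity.exists_isSubordinate (𝓡 (2 * d + 1))
    (isClosed_univ (X := M)) (fun i ↦ (extChartAt (𝓡 (2 * d + 1)) i).source)
    isOpen_extChartAt_source fun x _ ↦ mem_iUnion.2 ⟨x, mem_extChartAt_source x⟩
  choose Γ hΓsmooth hΓ using h.exists_isShsChristoffel hE
  exact ⟨_, isShsConnection_gluedCovariantDerivative hρ h.smooth_form hΓsmooth hΓ⟩

end Existence

section Perturbation

open Set Topology

variable {n : ℕ} {M : Type*} [TopologicalSpace M] [ChartedSpace (EuclideanSpace ℝ (Fin n)) M]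

/-- The 1-form `i_X Ω`. -/
def contraction (Ω : DiffForm (n := n) M 2) (X : ∀ x : M, TangentSpace (𝓡 n) x) (x : M) :
    TangentSpace (𝓡 n) x →L[ℝ] ℝ :=
  formBilin (EuclideanSpace ℝ (Fin n)) (Ω x) (X x)

theorem contraction_apply (Ω : DiffForm (n := n) M 2) (X : ∀ x : M, TangentSpace (𝓡 n) x) (x : M)
    (u : TangentSpace (𝓡 n) x) : contraction Ω X x u = Ω x ![X x, u] :=
  formBilin_apply (F := EuclideanSpace ℝ (Fin n)) (Ω x) (X x) u

variable [IsManifold (𝓡 n) ∞ M]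

/-- The connection `∇ + c • (i_X Ω) ⊗ (i_X Ω) ⊗ X`. The added tensor is symmetric in its two
arguments, and its contraction with `Ω` is totally symmetric. -/
def perturb (nabla : LinearConnection (n := n) M) (Ω : DiffForm (n := n) M 2)
    (X : ∀ x : M, TangentSpace (𝓡 n) x) (c : ℝ) : LinearConnection (n := n) M :=
  nabla.addOneForm fun x ↦
    (c • contraction Ω X x).smulRight ((contraction Ω X x).smulRight (X x))

variable {nabla : LinearConnection (n := n) M} {Ω : DiffForm (n := n) M 2}
  {E : ∀ x : M, TangentSpace (𝓡 n) x}

theorem perturb_apply (X Y : ∀ x : M, TangentSpace (𝓡 n) x) (c : ℝ) (x : M)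
    (u : TangentSpace (𝓡 n) x) :
    perturb nabla Ω X c Y x u = nabla Y x u + (c * Ω x ![X x, Y x] * Ω x ![X x, u]) • X x := by
  change nabla Y x u + (c * contraction Ω X x (Y x)) • contraction Ω X x u • X x = _
  rw [smul_smul, contraction_apply, contraction_apply]

theorem contMDiffAt_perturbation (hΩ : DiffForm.IsSmooth Ω) (X : SmoothVectorField (n := n) M)
    {σ : ∀ x : M, TangentSpace (𝓡 n) x} {x : M}
    (hσ : ContMDiffAt (𝓡 n) ((𝓡 n).prod (𝓡 n)) ∞
      (fun z ↦ (⟨z, σ z⟩ : TangentBundle (𝓡 n) M)) x) (c : ℝ) :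
    ContMDiffAt (𝓡 n) ((𝓡 n).prod
        𝓘(ℝ, EuclideanSpace ℝ (Fin n) →L[ℝ] EuclideanSpace ℝ (Fin n))) ∞
      (fun z ↦ (⟨z, (c * contraction Ω X z (σ z)) • (contraction Ω X z).smulRight (X z)⟩ :
        TotalSpace (EuclideanSpace ℝ (Fin n) →L[ℝ] EuclideanSpace ℝ (Fin n))
          fun z : M ↦ TangentSpace (𝓡 n) z →L[ℝ] TangentSpace (𝓡 n) z)) x := by
  have hx := mem_extChartAt_source (I := 𝓡 n) x
  have hβ := (contDiffOn_formBilin (hΩ x)).contDiffAt (extChartAt_target_mem_nhds_of_mem_source hx)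
  have hX := (contMDiffAt_iff_contDiffAt_chartField hx).1 (X.contMDiff x)
  rw [contMDiffAt_iff_contDiffAt_chartField hx] at hσ
  refine (contMDiffAt_endomorphism_iff
    (B := fun y ↦ (c * formBilin _ (Ω.inChart x y) (chartField x X y) (chartField x σ y)) •
      (formBilin _ (Ω.inChart x y) (chartField x X y)).smulRight (chartField x X y)) hx
    fun z hz u ↦ ?_).2 ?_
  · change chartD x z ((c * contraction Ω X z (σ z)) • contraction Ω X z u • X z) = _
    rw [map_smul, map_smul, contraction_apply, contraction_apply,
      apply_pair_eq_inChart Ω hz, apply_pair_eq_inChart Ω hz, ← chartField_extChartAt hz,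
      ← chartField_extChartAt hz]
    rfl
  · exact (contDiffAt_const.mul ((hβ.clm_apply hX).clm_apply hσ)).smul
      ((hβ.clm_apply hX).smulRight hX)

theorem contMDiff_perturb (hΩ : DiffForm.IsSmooth Ω)
    (hnabla : nabla.ContMDiffCovariantDerivative ∞) (X : SmoothVectorField (n := n) M) (c : ℝ) :
    (perturb nabla Ω X c).ContMDiffCovariantDerivative ∞ where
  contMDiff.contMDiff {σ} hσ := by
    have hnablaσ := hnabla.contMDiff.contMDiff hσ
    rw [contMDiffOn_univ] at hσ hnablaσ ⊢
    exact ContMDiff.add_section hnablaσ fun x ↦ contMDiffAt_perturbation hΩ X (hσ x) c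

theorem torsion_perturb_eq_zero (hnabla : nabla.torsion = 0) (X : ∀ x : M, TangentSpace (𝓡 n) x)
    (c : ℝ) : (perturb nabla Ω X c).torsion = 0 := by
  rw [CovariantDerivative.torsion_eq_zero_iff] at hnabla ⊢
  intro Y Z x hY hZ
  rw [← hnabla hY hZ, perturb_apply, perturb_apply, mul_right_comm]
  abel

theorem isParallelField_perturb (hnabla : IsParallelField nabla E)
    (hE : ∀ x w, Ω x ![E x, w] = 0) (X : ∀ x : M, TangentSpace (𝓡 n) x) (c : ℝ) :
    IsParallelField (perturb nabla Ω X c) E := fun x ↦ by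
  have hXE : Ω x ![X x, E x] = 0 :=
    (apply_pair_swap (Ω x).toAlternatingMap (X x) (E x)).trans (neg_eq_zero.2 (hE x _))
  ext1 u
  rw [perturb_apply, hnabla x, hXE, mul_zero, zero_mul, zero_smul, add_zero]

theorem isParallelForm_perturb (hnabla : IsParallelForm nabla Ω)
    (X : ∀ x : M, TangentSpace (𝓡 n) x) (c : ℝ) :
    IsParallelForm (perturb nabla Ω X c) Ω := fun Y Z x u ↦ by
  have hleft := apply_pair_add_smul_left (Ω x).toAlternatingMap
  have hright := apply_pair_add_smul_right (Ω x).toAlternatingMap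
  have hswap := apply_pair_swap (Ω x).toAlternatingMap (Y x) (X x)
  simp only [ContinuousAlternatingMap.coe_toAlternatingMap] at hleft hright hswap
  refine (hnabla Y Z x u).trans (?_ : (_ : ℝ) = _)
  rw [perturb_apply, perturb_apply, hleft, hright, hswap]
  ring

theorem isShsConnection_perturb (hΩ : DiffForm.IsSmooth Ω) (hE : ∀ x w, Ω x ![E x, w] = 0)
    (hnabla : IsShsConnection Ω E nabla) (X : SmoothVectorField (n := n) M) (c : ℝ) :
    IsShsConnection Ω E (perturb nabla Ω X c) where
  smooth := contMDiff_perturb hΩ hnabla.smooth X c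
  torsion_eq_zero := torsion_perturb_eq_zero hnabla.torsion_eq_zero X c
  parallel_field := isParallelField_perturb hnabla.parallel_field hE X c
  parallel_form := isParallelForm_perturb hnabla.parallel_form X c

theorem exists_smoothVectorField_eq [T2Space M] {x : M} (v : TangentSpace (𝓡 n) x) :
    ∃ X : SmoothVectorField (n := n) M, X x = v := by
  obtain ⟨s, hs, hσ⟩ := FiberBundle.exists_contMDiffOn_extend (k := ∞) (𝓡 n)
    (EuclideanSpace ℝ (Fin n)) v
  obtain ⟨f, -, hf⟩ := (SmoothBumpFunction.nhds_basis_tsupport (I := 𝓡 n) x).mem_iff.1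
    (interior_mem_nhds.2 hs)
  refine ⟨⟨_, ContMDiffOn.smul_section_of_tsupport f.contMDiff.contMDiffOn isOpen_interior hf
    (hσ.mono interior_subset)⟩, ?_⟩
  change f x • FiberBundle.extend (EuclideanSpace ℝ (Fin n)) v x = v
  rw [f.eq_one, one_smul, FiberBundle.extend_apply_self]

theorem IsShsConnection.infinite_onSmooth_image [T2Space M] (hΩ : DiffForm.IsSmooth Ω)
    (hE : ∀ x w, Ω x ![E x, w] = 0) (hnabla : IsShsConnection Ω E nabla) {x : M}
    {u w : TangentSpace (𝓡 n) x} (huw : Ω x ![u, w] ≠ 0) :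
    (onSmooth '' {nabla' : LinearConnection (n := n) M | IsShsConnection Ω E nabla'}).Infinite := by
  obtain ⟨X, rfl⟩ := exists_smoothVectorField_eq u
  obtain ⟨Y, rfl⟩ := exists_smoothVectorField_eq w
  have hX : X x ≠ 0 := fun hX ↦ huw (by rw [hX]; exact (Ω x).map_coord_zero 0 rfl)
  refine infinite_of_injective_forall_mem (f := fun c : ℝ ↦ onSmooth (perturb nabla Ω X c))
    (fun c c' hc ↦ ?_) fun c ↦ ⟨_, isShsConnection_perturb hΩ hE hnabla X c, rfl⟩
  have hcY : perturb nabla Ω X c Y x (Y x) = perturb nabla Ω X c' Y x (Y x) :=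
    congrArg (fun l ↦ l (Y x)) (congrFun (congrFun hc Y) x)
  rw [perturb_apply, perturb_apply, add_right_inj] at hcY
  exact mul_right_cancel₀ huw (mul_right_cancel₀ huw (smul_left_injective ℝ hX hcY))

end Perturbation

section Main

variable {d : ℕ} {M : Type*} [TopologicalSpace M]
  [ChartedSpace (EuclideanSpace ℝ (Fin (2 * d + 1))) M] [IsManifold (𝓡 (2 * d + 1)) ∞ M]
  {α : DiffForm (n := 2 * d + 1) M 1} {E : ∀ x : M, TangentSpace (𝓡 (2 * d + 1)) x}
  {nabla : LinearConnection (n := 2 * d + 1) M}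

theorem isShsConnection_extD_iff :
    IsShsConnection (DiffForm.extD α) E nabla ↔ IsContactConnection α E nabla :=
  ⟨fun ⟨smooth, torsion, field, form⟩ ↦ ⟨smooth, torsion, field, form⟩,
    fun ⟨smooth, torsion, field, form⟩ ↦ ⟨smooth, torsion, field, form⟩⟩

theorem mainTheorem2_general [T2Space M] [SecondCountableTopology M]
    {Ω : DiffForm (n := 2 * d + 1) M 2} (h : IsFramedHamiltonian Ω α) :
    ∃ E : SmoothVectorField (n := 2 * d + 1) M,
      IsReebField Ω α E ∧
      (∀ E' : ∀ x : M, TangentSpace (𝓡 (2 * d + 1)) x, IsReebField Ω α E' → ∀ x, E' x = E x) ∧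
      (∃ nabla : LinearConnection (n := 2 * d + 1) M, IsShsConnection Ω E nabla) ∧
      (0 < d → Nonempty M →
        (onSmooth '' {nabla : LinearConnection (n := 2 * d + 1) M |
          IsShsConnection Ω E nabla}).Infinite) ∧
      (Ω = DiffForm.extD α → ∀ nabla : LinearConnection (n := 2 * d + 1) M,
        IsShsConnection Ω E nabla ↔ IsContactConnection α E nabla) := by
  obtain ⟨E, hE⟩ := h.exists_isReebField
  obtain ⟨nabla, hnabla⟩ := h.exists_isShsConnection hE
  refine ⟨⟨E, hE.contMDiff h⟩, hE, fun E' hE' ↦ hE.eq h hE', ⟨nabla, hnabla⟩, fun hd ⟨x⟩ ↦ ?_, ?_⟩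
  · obtain ⟨u, w, huw⟩ := exists_apply_pair_ne_zero (finrank_tangentSpace x) hd (h.volume_ne_zero x)
    exact hnabla.infinite_onSmooth_image h.smooth_form (fun z ↦ (hE z).1) huw
  · rintro rfl nabla
    exact isShsConnection_extD_iff

end Main

end StableHamiltonian

end

theorem mainTheorem2 (d : ℕ) (M : Type*) [TopologicalSpace M] [T2Space M]
    [SecondCountableTopology M] [ChartedSpace (EuclideanSpace ℝ (Fin (2 * d + 1))) M]
    [IsManifold (𝓡 (2 * d + 1)) ∞ M]
    (Ω : StableHamiltonian.DiffForm (n := 2 * d + 1) M 2)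
    (α : StableHamiltonian.DiffForm (n := 2 * d + 1) M 1)
    (h : StableHamiltonian.IsStableHamiltonian Ω α) :
    ∃ E : StableHamiltonian.SmoothVectorField (n := 2 * d + 1) M,
      StableHamiltonian.IsReebField Ω α E ∧
      (∀ E' : ∀ x : M, TangentSpace (𝓡 (2 * d + 1)) x,
        StableHamiltonian.IsReebField Ω α E' → ∀ x, E' x = E x) ∧
      (∃ nabla : StableHamiltonian.LinearConnection (n := 2 * d + 1) M,
        StableHamiltonian.IsShsConnection Ω E nabla) ∧
      (0 < d → Nonempty M →
        (StableHamiltonian.onSmooth ''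
          {nabla : StableHamiltonian.LinearConnection (n := 2 * d + 1) M |
            StableHamiltonian.IsShsConnection Ω E nabla}).Infinite) ∧
      (Ω = StableHamiltonian.DiffForm.extD α → ∀ nabla : StableHamiltonian.LinearConnection (n := 2 * d + 1) M,
        StableHamiltonian.IsShsConnection Ω E nabla ↔
          StableHamiltonian.IsContactConnection α E nabla) :=
  StableHamiltonian.mainTheorem2_general h.isFramedHamiltonian
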